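/- Let $K$ be an algebraically closed field and let $\mathcal C$ be a semisimple $K$-linear ribbon category in the sense of Turaev: a $K$-linear braided monoidal category with $K$-bilinear tensor product, duals and a twist $\theta$ satisfying $\theta_{X\otimes Y}=c_{Y,X}c_{X,Y}(\theta_X\otimes\theta_Y)$ and $\theta_{X^*}=(\theta_X)^*$, in which $\mathrm{End}(1\!\!1)=K$, there are no nonzero morphisms between non-isomorphic simple objects, and every object is dominated by simple objects (its identity is a finite sum of morphisms factoring through objects $S$ with $\mathrm{End}(S)=K$). Let $\dim X\in K$ denote the ribbon dimension, i.e. the ribbon trace of $\mathrm{id}_X$. Let $Z$ be a simple object which is self-dual, i.e. $1\!\!1$ is a direct summand of $Z\otimes Z$ with multiplicity one. Suppose $Z\otimes Z\cong\bigoplus_{i=1}^d Y_i$ with mutually non-isomorphic simple objects $Y_i$ such that $\dim Y_i\neq 0$, and suppose that the braiding $c=c_{Z,Z}$ acts on $Y_i$ by a scalar $\lambda_i$, with $\lambda_i\ne\lambda_j$ for $i\neq j$. For $a\in \mathrm{End}(Z^{\otimes 2})$ put $a_1=a\otimes 1$ and $a_2=1\otimes a$ in $\mathrm{End}(Z^{\otimes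 3})$. Let $p^{(i)}\in\mathrm{End}(Z^{\otimes 2})$ be the projection onto $Y_i$. (1) The space $V=\mathrm{Hom}(Z,Z^{\otimes 3})$, with $\sigma_j f=c_j\circ f$ for $j=1,2$, is a simple $d$-dimensional module of the braid group $B_3=\langle\sigma_1,\sigma_2\mid\sigma_1\sigma_2\sigma_1=\sigma_2\sigma_1\sigma_2\rangle$. For $j=1,2$ the eigenvalues of $\sigma_j$ on $V$ are exactly $\lambda_1,\dots,\lambda_d$, each of (algebraic) multiplicity $1$. (2) Some $Y_i$ is isomorphic to $1\!\!1$; label it $Y_1$. With $p=p^{(1)}$ one has $(\dim Y_i)\,p_2=(\dim Z)^2\,p_2\,(p^{(i)}\otimes 1)\,p_2$ for all $i$. (3) Let $A$ and $B$ be the endomorphisms of $V$ by which $\sigma_1$ and $\sigma_2$ act, and let $P^{(d)}_r(x)=\prod_{i\ne r}(x-\lambda_i)$. For all $r,s$ there is a unique scalar $Q^{(d)}_{rs}\in K$ with $P^{(d)}_r(A)P^{(d)}_s(B)P^{(d)}_r(A)=Q^{(d)}_{rs}P^{(d)}_r(A)$, and $$\dim Y_i=\frac{Q^{(d)}_{1i}\,(\dim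 Z)^2}{P^{(d)}_1(\lambda_1)\,P^{(d)}_i(\lambda_i)}\qquad (1\le i\le d).$$ For $r\neq s$ and $2\le d\le 5$ the scalars $Q^{(d)}_{rs}$ are given by $$Q^{(2)}_{rs}=-\lambda_r^2+\lambda_r\lambda_s-\lambda_s^2,\qquad Q^{(3)}_{rs}=(\lambda_r^2+\lambda_s\lambda_k)(\lambda_s^2+\lambda_r\lambda_k),$$ $$Q^{(4)}_{rs}=-\gamma^{-2}(\lambda_r^2+\gamma^2)(\lambda_s^2+\gamma^2)(\gamma^2+\lambda_r\lambda_k+\lambda_s\lambda_l)(\gamma^2+\lambda_r\lambda_l+\lambda_s\lambda_k),$$ $$Q^{(5)}_{rs}=\gamma^{-8}(\gamma^2+\lambda_r\gamma+\lambda_r^2)(\gamma^2+\lambda_s\gamma+\lambda_s^2)\prod_{k\ne r,s}(\gamma^2+\lambda_r\lambda_k)(\gamma^2+\lambda_s\lambda_k),$$ where $\{r,s,k\}=\{1,2,3\}$ for $d=3$ and $\{r,s,k,l\}=\{1,2,3,4\}$ for $d=4$, and where, for $d=4,5$, $\gamma\in K$ is any element with $\gamma^d=\lambda_1\cdots\lambda_d$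 such that $(\sigma_1\sigma_2)^3$ acts on $V$ by the scalar $(-1)^{d+1}\gamma^6$; such a $\gamma$ exists. -/

import Mathlib

open CategoryTheory MonoidalCategory Limits Polynomial

universe w v u

noncomputable section

namespace BraidDim

section Categories

variable (K : Type w) [Field K] {C : Type u} [Category.{v} C] [Preadditive C] [Linear K C]

/-- The endomorphisms of `X` are exactly the scalars. In Turaev's terminology, `X` is simple. -/
def ScalarEnd (X : C) : Prop :=
  Function.Bijective (fun a : K => a • 𝟙 X)

variable (C) in
/-- A semisimple `K`-linear monoidal category in the sense of Turaev: the ground field is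
`End(𝟙)`, there are no nonzero morphisms between non-isomorphic objects with scalar
endomorphisms, and every object is dominated by such objects.  Direct sums and kernels are not
required to exist. An abelian `K`-linear monoidal category with finite-dimensional `Hom` spaces
and simple unit, in which every object is a finite direct sum of simple objects, is an example
when `K` is algebraically closed. -/
class SemisimpleCategory [MonoidalCategory C] : Prop where
  scalarEnd_unit : ScalarEnd K (𝟙_ C)
  hom_eq_zero : ∀ {X Y : C}, ScalarEnd K X → ScalarEnd K Y → IsEmpty (X ≅ Y) →
    ∀ f : X ⟶ Y, f = 0
  domination : ∀ X : C, ∃ (n : ℕ) (S : Fin n → C) (f : ∀ k, X ⟶ S k) (g : ∀ k, S k ⟶ X),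
    (∀ k, ScalarEnd K (S k)) ∧ ∑ k, f k ≫ g k = 𝟙 X

end Categories

section Ribbon

/-- A ribbon structure on a braided category with duals: a natural twist compatible with the
braiding and the duality. -/
class RibbonCategory (C : Type u) [Category.{v} C] [MonoidalCategory C] [BraidedCategory C]
    [RightRigidCategory C] where
  twist : ∀ X : C, X ≅ X
  twist_naturality : ∀ {X Y : C} (f : X ⟶ Y), f ≫ (twist Y).hom = (twist X).hom ≫ f
  twist_tensor : ∀ X Y : C, (twist (X ⊗ Y)).hom =
    ((twist X).hom ⊗ₘ (twist Y).hom) ≫ (β_ X Y).hom ≫ (β_ Y X).hom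
  twist_dual : ∀ X : C, (twist Xᘁ).hom = (twist X).homᘁ

variable {C : Type u} [Category.{v} C] [MonoidalCategory C] [BraidedCategory C]
  [RightRigidCategory C] [RibbonCategory C]

/-- The ribbon (quantum) trace of an endomorphism,
`ev ∘ c_{X, X*} ∘ ((θ_X ∘ f) ⊗ id) ∘ coev`. -/
def ribbonTrace {X : C} (f : X ⟶ X) : 𝟙_ C ⟶ 𝟙_ C :=
  η_ X Xᘁ ≫ (f ≫ (RibbonCategory.twist X).hom) ▷ Xᘁ ≫ (β_ X Xᘁ).hom ≫ ε_ X Xᘁ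

/-- The categorical dimension of `X`: the scalar `a` with `ribbonTrace (𝟙 X) = a • 𝟙`. -/
def catDim (K : Type w) [Field K] [Preadditive C] [Linear K C] [SemisimpleCategory K C]
    (X : C) : K :=
  (Equiv.ofBijective _ (SemisimpleCategory.scalarEnd_unit (K := K) (C := C))).symm
    (ribbonTrace (𝟙 X))

theorem catDim_smul_id (K : Type w) [Field K] [Preadditive C] [Linear K C]
    [SemisimpleCategory K C] (X : C) : catDim K X • 𝟙 (𝟙_ C) = ribbonTrace (𝟙 X) :=
  (Equiv.ofBijective _
    (SemisimpleCategory.scalarEnd_unit (K := K) (C := C))).apply_symm_apply _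

end Ribbon

section SelfDual

/-- `Z` is self-dual: the trivial object is a direct summand of `Z ⊗ Z`, of multiplicity one. -/
def IsSelfDual (K : Type w) [Field K] {C : Type u} [Category.{v} C] [Preadditive C] [Linear K C]
    [MonoidalCategory C] (Z : C) : Prop :=
  ∃ (i : 𝟙_ C ⟶ Z ⊗ Z) (p : Z ⊗ Z ⟶ 𝟙_ C),
    i ≫ p = 𝟙 _ ∧ ∀ j : 𝟙_ C ⟶ Z ⊗ Z, ∃ a : K, j = a • i

/-- `Z^{⊗ 3}`. -/
abbrev cube {C : Type u} [Category.{v} C] [MonoidalCategory C] (Z : C) : C := (Z ⊗ Z) ⊗ Z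

/-- `a ⊗ 1` on `Z^{⊗ 3}`, for `a ∈ End(Z ⊗ Z)`. -/
def actLeft {C : Type u} [Category.{v} C] [MonoidalCategory C] {Z : C} (a : Z ⊗ Z ⟶ Z ⊗ Z) :
    cube Z ⟶ cube Z :=
  a ▷ Z

/-- `1 ⊗ a` on `Z^{⊗ 3}`, for `a ∈ End(Z ⊗ Z)`. -/
def actRight {C : Type u} [Category.{v} C] [MonoidalCategory C] {Z : C} (a : Z ⊗ Z ⟶ Z ⊗ Z) :
    cube Z ⟶ cube Z :=
  (α_ Z Z Z).hom ≫ Z ◁ a ≫ (α_ Z Z Z).inv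

/-- The projection of `X` onto the `i`-th summand in a direct sum decomposition. -/
def summandProj {C : Type u} [Category.{v} C] [Preadditive C] {ι : Type} {X : C} {Y : ι → C}
    [HasBiproduct Y] (e : X ≅ ⨁ Y) (i : ι) : X ⟶ X :=
  (e.hom ≫ biproduct.π Y i) ≫ biproduct.ι Y i ≫ e.inv

end SelfDual

section Braid

/-- The braid relation `σ₁σ₂σ₁ = σ₂σ₁σ₂`. -/
def braidRels : Set (FreeGroup (Fin 2)) :=
  {FreeGroup.of 0 * FreeGroup.of 1 * FreeGroup.of 0 *
    (FreeGroup.of 1 * FreeGroup.of 0 * FreeGroup.of 1)⁻¹}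

/-- Artin's braid group on three strands. -/
abbrev B3 : Type := PresentedGroup braidRels

/-- The generators `σ₁` (index `0`) and `σ₂` (index `1`). -/
def braidGen (j : Fin 2) : B3 := PresentedGroup.of j

variable {C : Type u} [Category.{v} C] [MonoidalCategory C] [BraidedCategory C]

/-- The automorphisms `c₁ = c ⊗ 1` and `c₂ = 1 ⊗ c` of `Z^{⊗ 3}`, with `c` the braiding. -/
def braidAut (Z : C) : Fin 2 → Aut (cube Z) :=
  ![whiskerRightIso (β_ Z Z) Z,
    α_ Z Z Z ≪≫ whiskerLeftIso Z (β_ Z Z) ≪≫ (α_ Z Z Z).symm]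

theorem braidAut_zero_hom (Z : C) : (braidAut Z 0).hom = actLeft (β_ Z Z).hom := rfl

theorem braidAut_one_hom (Z : C) : (braidAut Z 1).hom = actRight (β_ Z Z).hom := rfl

theorem braidAut_rel (Z : C) :
    braidAut Z 0 * braidAut Z 1 * braidAut Z 0 = braidAut Z 1 * braidAut Z 0 * braidAut Z 1 := by
  apply Iso.ext
  have h := BraidedCategory.yang_baxter Z Z Z
  rw [Iso.inv_comp_eq] at h
  change actLeft (β_ Z Z).hom ≫ actRight (β_ Z Z).hom ≫ actLeft (β_ Z Z).hom =
    actRight (β_ Z Z).hom ≫ actLeft (β_ Z Z).hom ≫ actRight (β_ Z Z).hom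
  simp only [actLeft, actRight, Category.assoc]
  rw [← cancel_mono (α_ Z Z Z).hom]
  simp only [Category.assoc, Iso.inv_hom_id, Category.comp_id]
  exact h

/-- The action of `B₃` on `Z^{⊗ 3}`. -/
def braidHom (Z : C) : B3 →* Aut (cube Z) :=
  PresentedGroup.toGroup (f := braidAut Z) (by
    rintro r rfl
    simpa only [map_mul, map_inv, FreeGroup.lift_apply_of, mul_inv_eq_one] using braidAut_rel Z)

variable (K : Type w) [Field K] [Preadditive C] [Linear K C]

/-- The `B₃`-module `Hom(Z, Z^{⊗ 3})`, on which `σ_j` acts by `f ↦ c_j ∘ f`. -/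
def braidRep (Z : C) : Representation K B3 (Z ⟶ cube Z) where
  toFun b := Linear.rightComp K Z (braidHom Z b).hom
  map_one' := by
    ext f
    rw [map_one]
    exact Category.comp_id f
  map_mul' a b := by
    ext f
    rw [map_mul]
    exact (Category.assoc f _ _).symm

theorem braidRep_braidGen_apply (Z : C) (j : Fin 2) (f : Z ⟶ cube Z) :
    braidRep K Z (braidGen j) f = f ≫ (braidAut Z j).hom := by
  simp [braidRep, braidGen, braidHom]

end Braid

section Polynomials

variable {K : Type w} [Field K] {d : ℕ}

/-- `P_r^{(d)}(x) = ∏_{i ≠ r} (x - λ_i)`. -/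
def polyP (lam : Fin d → K) (r : Fin d) : K[X] :=
  ∏ i ∈ Finset.univ.erase r, (X - C (lam i))

/-- `Q_{rs}^{(2)}`, with `a = λ_r`, `b = λ_s`. -/
def polyQ2 (a b : K) : K := -a ^ 2 + a * b - b ^ 2

/-- `Q_{rs}^{(3)}`, with `a = λ_r`, `b = λ_s` and `k` the remaining eigenvalue. -/
def polyQ3 (a b k : K) : K := (a ^ 2 + b * k) * (b ^ 2 + a * k)

/-- `Q_{rs}^{(4)}`, with `a = λ_r`, `b = λ_s` and `k`, `l` the remaining eigenvalues. -/
def polyQ4 (γ a b k l : K) : K :=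
  -(γ ^ 2)⁻¹ * (a ^ 2 + γ ^ 2) * (b ^ 2 + γ ^ 2) *
    (γ ^ 2 + a * k + b * l) * (γ ^ 2 + a * l + b * k)

/-- `Q_{rs}^{(5)}`, with `a = λ_r`, `b = λ_s` and `k`, `l`, `m` the remaining eigenvalues. -/
def polyQ5 (γ a b k l m : K) : K :=
  (γ ^ 8)⁻¹ * (γ ^ 2 + a * γ + a ^ 2) * (γ ^ 2 + b * γ + b ^ 2) *
    (((γ ^ 2 + a * k) * (γ ^ 2 + b * k)) * ((γ ^ 2 + a * l) * (γ ^ 2 + b * l)) *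
      ((γ ^ 2 + a * m) * (γ ^ 2 + b * m)))

/-- `γ` is a `d`-th root of `det(σ₁) = ∏ λ_i` on the representation `ρ`, chosen such that
`(σ₁σ₂σ₁)² = (σ₁σ₂)³` acts by `(-1)^{d+1} γ⁶`. -/
def IsGamma {V : Type v} [AddCommGroup V] [Module K V] (ρ : Representation K B3 V)
    (lam : Fin d → K) (γ : K) : Prop :=
  γ ^ d = ∏ i, lam i ∧
    ρ ((braidGen 0 * braidGen 1 * braidGen 0) ^ 2) = ((-1) ^ (d + 1) * γ ^ 6) • (1 : V →ₗ[K] V)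

/-- `Q` is the family `Q_{rs}^{(d)}` for the representation `ρ`, on which `σ₁` has the
eigenvalues `λ_i`: with `A = ρ(σ₁)` and `B = ρ(σ₂)`, the scalar `Q_{rs}` is the unique one
with `P_r(A) P_s(B) P_r(A) = Q_{rs} P_r(A)`; for `2 ≤ d ≤ 5` and `r ≠ s` it is the value of
an explicit Laurent polynomial in the `λ_i` and, for `d = 4, 5`, in `γ`. -/
structure IsQFamily {V : Type v} [AddCommGroup V] [Module K V] (ρ : Representation K B3 V)
    (lam : Fin d → K) (Q : Fin d → Fin d → K) : Prop where
  relation : ∀ (r s : Fin d) (q : K),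
    aeval (ρ (braidGen 0)) (polyP lam r) * aeval (ρ (braidGen 1)) (polyP lam s) *
      aeval (ρ (braidGen 0)) (polyP lam r) = q • aeval (ρ (braidGen 0)) (polyP lam r) ↔ q = Q r s
  two : d = 2 → ∀ r s : Fin d, r ≠ s → Q r s = polyQ2 (lam r) (lam s)
  three : d = 3 → ∀ r s k : Fin d, [r, s, k].Nodup →
    Q r s = polyQ3 (lam r) (lam s) (lam k)
  four : d = 4 → (∃ γ, IsGamma ρ lam γ) ∧ ∀ γ, IsGamma ρ lam γ →
    ∀ r s k l : Fin d, [r, s, k, l].Nodup →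
      Q r s = polyQ4 γ (lam r) (lam s) (lam k) (lam l)
  five : d = 5 → (∃ γ, IsGamma ρ lam γ) ∧ ∀ γ, IsGamma ρ lam γ →
    ∀ r s k l m : Fin d, [r, s, k, l, m].Nodup →
      Q r s = polyQ5 γ (lam r) (lam s) (lam k) (lam l) (lam m)

end Polynomials

end BraidDim

end

open BraidDim

/-!
Duality identifies `Hom(Z, Z³)` with `End(Z²)`, so that the projections of `Z²` onto the summands
`Y_i` become a basis of eigenvectors of `σ₁` with eigenvalues `λ_i`. Let `T` be the matrix of the
half twist `σ₁σ₂σ₁` in this basis and `o` the index of the unit summand. A partial trace evaluates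
the compression of `p⁽ⁱ⁾ ⊗ 1` by `p₂` to `dim Y_i / (dim Z)²`, and the same number is the product of
two entries of `T` in the row and the column of `o`, up to a nonzero factor. As it does not vanish,
`T` has no zero in the row and the column of `o`; this forces irreducibility, and then the central
element `(σ₁σ₂)³` acts by a scalar `z`, that is, `T² = z`.

The scalars `Q_rs` are expressed through `T_rr` and `T_rs T_sr`. With `D = diag(λ_i)` the braid
relation reads `T D⁻¹ T = D T D`; its entries and traces determine the power sums `∑ T_kk λ_k ^ j`,
and hence these entries, in terms of the `λ_i` and `z`. For `d = 4` the trace of `T` comes out zero,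
so that `det T = z²`; for `d = 5` the multiplicities of the eigenvalues of `T` and of the cube root
`T D⁻¹` of `z` are limited, because no eigenspace of the one meets an eigenspace of the other, which
gives both traces and determinants. Comparing determinants then produces `γ`.
-/

noncomputable section

namespace BraidDim

section BraidMatrices

variable {K : Type*} [Field K] {ι : Type*} [Fintype ι]

/-- The power sums `∑ T_kk λ_k ^ j`, that is, the traces of the matrices `T * diag(λ_k) ^ j`. -/
def moment (T : Matrix ι ι K) (lam : ι → K) (j : ℤ) : K :=
  ∑ k, T k k * lam k ^ j

theorem moment_smul_inv (T : Matrix ι ι K) (lam : ι → K) (c : K) (j : ℤ) :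
    moment (c • T) lam⁻¹ j = c * moment T lam (-j) := by
  simp only [moment, Matrix.smul_apply, smul_eq_mul, Pi.inv_apply, inv_zpow', mul_assoc,
    Finset.mul_sum]

theorem apply_self_mul_eq_moments (T : Matrix ι ι K) {lam : ι → K} (hlam : ∀ i, lam i ≠ 0)
    (a b c d e : K) {r : ι}
    (hf : ∀ k ≠ r, a * lam k ^ 4 + b * lam k ^ 3 + c * lam k ^ 2 + d * lam k + e = 0) :
    T r r * (a * lam r ^ 4 + b * lam r ^ 3 + c * lam r ^ 2 + d * lam r + e) =
      lam r ^ 2 * (a * moment T lam 2 + b * moment T lam 1 + c * moment T lam 0 +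
        d * moment T lam (-1) + e * moment T lam (-2)) := by
  classical
  have hsum : a * moment T lam 2 + b * moment T lam 1 + c * moment T lam 0 +
      d * moment T lam (-1) + e * moment T lam (-2) =
      ∑ k, T k k * ((a * lam k ^ 4 + b * lam k ^ 3 + c * lam k ^ 2 + d * lam k + e) /
        lam k ^ 2) := by
    simp only [moment, Finset.mul_sum, ← Finset.sum_add_distrib]
    refine Finset.sum_congr rfl fun k _ => ?_
    have := hlam k
    simp only [zpow_neg, zpow_ofNat]
    field_simp
  rw [hsum, Fintype.sum_eq_single r fun k hk => by rw [hf k hk, zero_div, mul_zero]]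
  have := hlam r
  field_simp

variable [DecidableEq ι]

/-- The matrix `T` of the half twist `σ₁σ₂σ₁` in a basis of eigenvectors of `σ₁` with eigenvalues
`λ_i`, when the full twist `(σ₁σ₂)³` acts by the scalar `z`. With `D = diag(λ_i)` the matrix of
`σ₂` is `T D T⁻¹`, so that `rel` is the braid relation. -/
structure IsBraidMatrix (T : Matrix ι ι K) (lam : ι → K) (z : K) : Prop where
  ne_zero : ∀ i, lam i ≠ 0
  injective : Function.Injective lam
  scalar_ne_zero : z ≠ 0
  sq : T * T = z • 1
  rel : T * Matrix.diagonal lam⁻¹ * T = Matrix.diagonal lam * T * Matrix.diagonal lam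

/-- A braid matrix without zero entries in the row and the column of `o`. This is the form in
which the irreducibility of the braid group action enters the computations. -/
structure IsGenericBraidMatrix (T : Matrix ι ι K) (lam : ι → K) (z : K) (o : ι) : Prop
    extends IsBraidMatrix T lam z where
  row_ne_zero : ∀ s, T o s ≠ 0
  col_ne_zero : ∀ s, T s o ≠ 0

namespace IsBraidMatrix

variable {T : Matrix ι ι K} {lam : ι → K} {z : K}

theorem prod_ne_zero (h : IsBraidMatrix T lam z) : ∏ i, lam i ≠ 0 :=
  Finset.prod_ne_zero_iff.2 fun i _ => h.ne_zero i

theorem diagonal_mul_inv (h : IsBraidMatrix T lam z) :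
    Matrix.diagonal lam * Matrix.diagonal lam⁻¹ = 1 := by
  simp [Matrix.diagonal_mul_diagonal, h.ne_zero]

theorem inv_mul_diagonal (h : IsBraidMatrix T lam z) :
    Matrix.diagonal lam⁻¹ * Matrix.diagonal lam = 1 :=
  mul_eq_one_comm.1 h.diagonal_mul_inv

theorem rel_inv (h : IsBraidMatrix T lam z) :
    T * Matrix.diagonal lam * T =
      z • (Matrix.diagonal lam⁻¹ * T * Matrix.diagonal lam⁻¹) := by
  calc T * Matrix.diagonal lam * T
      = Matrix.diagonal lam⁻¹ * (Matrix.diagonal lam * T * Matrix.diagonal lam) * T := by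
        simp only [← mul_assoc, h.inv_mul_diagonal, one_mul]
    _ = Matrix.diagonal lam⁻¹ * T * Matrix.diagonal lam⁻¹ * (T * T) := by
        simp only [← h.rel, mul_assoc]
    _ = _ := by rw [h.sq, mul_smul_comm, mul_one]

/-- The braid matrix obtained by replacing `σ₁`, `σ₂` by their inverses. -/
theorem inv (h : IsBraidMatrix T lam z) : IsBraidMatrix (z⁻¹ • T) lam⁻¹ z⁻¹ where
  ne_zero i := inv_ne_zero (h.ne_zero i)
  injective i j hij := h.injective (inv_injective hij)
  scalar_ne_zero := inv_ne_zero h.scalar_ne_zero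
  sq := by
    rw [smul_mul_smul_comm, h.sq, smul_smul, mul_assoc, inv_mul_cancel₀ h.scalar_ne_zero, mul_one]
  rel := by
    rw [inv_inv, smul_mul_assoc, smul_mul_smul_comm, h.rel_inv, smul_smul, mul_assoc,
      inv_mul_cancel₀ h.scalar_ne_zero, mul_one, mul_smul_comm, smul_mul_assoc]

theorem moment_neg_two (h : IsBraidMatrix T lam z) : moment T lam (-2) = ∑ k, lam k := by
  have htrace := congrArg Matrix.trace h.rel_inv
  rw [Matrix.trace_mul_cycle, h.sq, Matrix.trace_smul, smul_mul_assoc, one_mul,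
    Matrix.trace_smul] at htrace
  rw [← Matrix.trace_diagonal, smul_right_injective K h.scalar_ne_zero htrace, Matrix.trace,
    moment]
  refine Finset.sum_congr rfl fun k _ => ?_
  rw [Matrix.diag_apply, Matrix.mul_diagonal, Matrix.diagonal_mul, Pi.inv_apply, zpow_neg,
    zpow_ofNat]
  ring

theorem moment_two (h : IsBraidMatrix T lam z) : moment T lam 2 = z * ∑ k, (lam k)⁻¹ := by
  have hinv := h.inv.moment_neg_two
  rw [moment_smul_inv, neg_neg, inv_mul_eq_iff_eq_mul₀ h.scalar_ne_zero] at hinv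
  exact hinv

theorem det_ne_zero (h : IsBraidMatrix T lam z) : T.det ≠ 0 := by
  intro h0
  have hsq := congrArg Matrix.det h.sq
  rw [Matrix.det_mul, h0, zero_mul, Matrix.det_smul, Matrix.det_one, mul_one] at hsq
  exact pow_ne_zero _ h.scalar_ne_zero hsq.symm

theorem det_diagonal_inv (h : IsBraidMatrix T lam z) :
    (Matrix.diagonal lam⁻¹).det * ∏ i, lam i = 1 := by
  rw [← Matrix.det_diagonal (d := lam), ← Matrix.det_mul, h.inv_mul_diagonal, Matrix.det_one]

theorem det_eq (h : IsBraidMatrix T lam z) : T.det = (∏ i, lam i) ^ 3 := by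
  have hrel := congrArg Matrix.det h.rel
  simp only [Matrix.det_mul, Matrix.det_diagonal (d := lam)] at hrel
  apply mul_right_cancel₀ h.det_ne_zero
  linear_combination (∏ i, lam i) * hrel - T.det ^ 2 * h.det_diagonal_inv

theorem sum_mul_mul (h : IsBraidMatrix T lam z) (α β κ : K) (r s : ι) :
    ∑ k, T r k * T k s * (α + β * (lam k)⁻¹ + κ * lam k) =
      (if r = s then α * z else 0) +
        (β * (lam r * lam s) + κ * z * (lam r * lam s)⁻¹) * T r s := by
  have hsq : ∑ k, T r k * T k s = z * if r = s then 1 else 0 := by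
    simpa only [Matrix.mul_apply, Matrix.smul_apply, Matrix.one_apply, smul_eq_mul]
      using congrFun₂ h.sq r s
  have hrel : ∑ k, T r k * (lam k)⁻¹ * T k s = lam r * T r s * lam s := by
    have := congrFun₂ h.rel r s
    rw [Matrix.mul_diagonal, Matrix.diagonal_mul, Matrix.mul_apply] at this
    simpa only [Matrix.mul_diagonal, Pi.inv_apply] using this
  have hrel_inv : ∑ k, T r k * lam k * T k s = z * ((lam r)⁻¹ * T r s * (lam s)⁻¹) := by
    have := congrFun₂ h.rel_inv r s
    rw [Matrix.smul_apply, Matrix.mul_diagonal, Matrix.diagonal_mul, Matrix.mul_apply] at this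
    simpa only [Matrix.mul_diagonal, Pi.inv_apply, smul_eq_mul] using this
  calc _ = α * ∑ k, T r k * T k s + β * ∑ k, T r k * (lam k)⁻¹ * T k s +
        κ * ∑ k, T r k * lam k * T k s := by
        simp only [Finset.mul_sum, ← Finset.sum_add_distrib]
        exact Finset.sum_congr rfl fun k _ => by ring
    _ = _ := by
      rw [hsq, hrel, hrel_inv, mul_inv]
      split_ifs <;> ring

theorem add_inv_add_eq_zero (h : IsBraidMatrix T lam z) {α β κ : K} {k : ι}
    (hf : β + α * lam k + κ * lam k ^ 2 = 0) : α + β * (lam k)⁻¹ + κ * lam k = 0 := by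
  have := h.ne_zero k
  field_simp
  linear_combination hf

theorem apply_mul_apply_mul (h : IsBraidMatrix T lam z) {α β κ : K} {r s : ι} (hrs : r ≠ s)
    (hf : ∀ k, k ≠ r → k ≠ s → β + α * lam k + κ * lam k ^ 2 = 0) :
    lam r ^ 2 * (T r s * T s r * (β + α * lam s + κ * lam s ^ 2)) =
      lam s * (α * z * lam r ^ 2 + (β * lam r ^ 4 + κ * z) * T r r -
        T r r ^ 2 * lam r * (β + α * lam r + κ * lam r ^ 2)) := by
  have hsum := h.sum_mul_mul α β κ r r
  rw [if_pos rfl, Fintype.sum_eq_add r s hrs fun k hk => by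
    rw [h.add_inv_add_eq_zero (hf k hk.1 hk.2), mul_zero]] at hsum
  have := h.ne_zero r
  have := h.ne_zero s
  field_simp at hsum
  linear_combination hsum

theorem moments_eq_of_apply_ne_zero (h : IsBraidMatrix T lam z) {α β κ : K} {r s : ι} (hrs : r ≠ s)
    (hT : T r s ≠ 0) (hf : ∀ k, k ≠ r → k ≠ s → β + α * lam k + κ * lam k ^ 2 = 0) :
    (β * moment T lam (-1) + α * moment T lam 0 + κ * moment T lam 1) * (lam r * lam s) =
      β * (lam r * lam s) ^ 2 + κ * z := by
  have hf' (k : ι) (hk : k ≠ r ∧ k ≠ s) := h.add_inv_add_eq_zero (hf k hk.1 hk.2)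
  have hsum := h.sum_mul_mul α β κ r s
  rw [if_neg hrs, zero_add, Fintype.sum_eq_add r s hrs fun k hk => by rw [hf' k hk, mul_zero]]
    at hsum
  have hmoments : β * moment T lam (-1) + α * moment T lam 0 + κ * moment T lam 1 =
      T r r * (α + β * (lam r)⁻¹ + κ * lam r) + T s s * (α + β * (lam s)⁻¹ + κ * lam s) := by
    rw [← Fintype.sum_eq_add (f := fun k => T k k * (α + β * (lam k)⁻¹ + κ * lam k)) r s hrs
      fun k hk => by rw [hf' k hk, mul_zero]]
    simp only [moment, Finset.mul_sum, ← Finset.sum_add_distrib]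
    refine Finset.sum_congr rfl fun k _ => ?_
    simp only [zpow_neg, zpow_one, zpow_zero]
    ring
  have hwindow : β * moment T lam (-1) + α * moment T lam 0 + κ * moment T lam 1 =
      β * (lam r * lam s) + κ * z * (lam r * lam s)⁻¹ :=
    mul_right_cancel₀ hT (by linear_combination T r s * hmoments + hsum)
  have := h.ne_zero r
  have := h.ne_zero s
  rw [hwindow]
  field_simp

end IsBraidMatrix

theorem IsGenericBraidMatrix.inv {T : Matrix ι ι K} {lam : ι → K} {z : K} {o : ι}
    (h : IsGenericBraidMatrix T lam z o) : IsGenericBraidMatrix (z⁻¹ • T) lam⁻¹ z⁻¹ o where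
  toIsBraidMatrix := h.toIsBraidMatrix.inv
  row_ne_zero s := mul_ne_zero (inv_ne_zero h.scalar_ne_zero) (h.row_ne_zero s)
  col_ne_zero s := mul_ne_zero (inv_ne_zero h.scalar_ne_zero) (h.col_ne_zero s)

end BraidMatrices

section Eigenvalues

variable {K : Type*} [Field K] {d : ℕ}

theorem toFinset_eq_univ_of_nodup {l : List (Fin d)} (hl : l.Nodup) (hd : l.length = d) :
    l.toFinset = Finset.univ := by
  apply Finset.eq_univ_of_card
  rw [List.toFinset_card_of_nodup hl, Fintype.card_fin, hd]

theorem mem_of_nodup_of_length_eq {l : List (Fin d)} (hl : l.Nodup) (hd : l.length = d)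
    (i : Fin d) : i ∈ l := by
  rw [← List.mem_toFinset, toFinset_eq_univ_of_nodup hl hd]
  exact Finset.mem_univ i

theorem prod_univ_eq_list_prod {l : List (Fin d)} (hl : l.Nodup) (hd : l.length = d)
    (f : Fin d → K) : ∏ i, f i = (l.map f).prod := by
  rw [← List.prod_toFinset f hl, toFinset_eq_univ_of_nodup hl hd]

theorem sum_univ_eq_list_sum {l : List (Fin d)} (hl : l.Nodup) (hd : l.length = d)
    (f : Fin d → K) : ∑ i, f i = (l.map f).sum := by
  rw [← List.sum_toFinset f hl, toFinset_eq_univ_of_nodup hl hd]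

theorem eval_polyP_self (lam : Fin d → K) (r : Fin d) :
    (polyP lam r).eval (lam r) = ∏ i ∈ Finset.univ.erase r, (lam r - lam i) := by
  simp only [polyP, eval_prod, eval_sub, eval_X, eval_C]

theorem eval_polyP_of_ne (lam : Fin d → K) {r i : Fin d} (h : i ≠ r) :
    (polyP lam r).eval (lam i) = 0 := by
  rw [polyP, eval_prod]
  exact Finset.prod_eq_zero (Finset.mem_erase.2 ⟨h, Finset.mem_univ i⟩) (by simp)

theorem eval_polyP_self_ne_zero {lam : Fin d → K} (h : Function.Injective lam) (r : Fin d) :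
    (polyP lam r).eval (lam r) ≠ 0 := by
  rw [eval_polyP_self, Finset.prod_ne_zero_iff]
  intro i hi
  exact sub_ne_zero.2 (h.ne (Finset.ne_of_mem_erase hi).symm)

theorem eval_polyP_eq_list_prod (lam : Fin d → K) {r : Fin d} {l : List (Fin d)}
    (hl : (r :: l).Nodup) (hd : (r :: l).length = d) :
    (polyP lam r).eval (lam r) = (l.map fun i => lam r - lam i).prod := by
  have hr : r ∉ l.toFinset := List.mem_toFinset.not.2 (List.nodup_cons.1 hl).1
  rw [eval_polyP_self, ← List.prod_toFinset _ (List.nodup_cons.1 hl).2,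
    ← toFinset_eq_univ_of_nodup hl hd, List.toFinset_cons, Finset.erase_insert hr]

end Eigenvalues

section LowDimension

variable {K : Type*} [Field K] {z : K}

namespace IsGenericBraidMatrix

theorem moments_two {T : Matrix (Fin 2) (Fin 2) K} {lam : Fin 2 → K} {o : Fin 2}
    (h : IsGenericBraidMatrix T lam z o) :
    moment T lam 0 = 0 ∧ moment T lam (-1) = ∏ i, lam i ∧ z = -(∏ i, lam i) ^ 3 := by
  obtain ⟨s, hs⟩ : ∃ s, [o, s].Nodup := by
    clear h
    revert o
    decide
  have hos : o ≠ s := by simpa using hs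
  have window (α β : K) := h.moments_eq_of_apply_ne_zero (α := α) (β := β) (κ := 0) hos
    (h.row_ne_zero s) fun k h1 h2 => by
      simpa [h1, h2] using mem_of_nodup_of_length_eq hs rfl k
  have hD := h.prod_ne_zero
  rw [prod_univ_eq_list_prod hs rfl] at hD ⊢
  simp only [List.map_cons, List.map_nil, List.prod_cons, List.prod_nil, mul_one] at hD ⊢
  have h0 : moment T lam 0 = 0 :=
    (mul_eq_zero.1 (by linear_combination window 1 0)).resolve_right hD
  refine ⟨h0, mul_right_cancel₀ hD (by linear_combination window 0 1), ?_⟩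
  have hsq : T 0 0 * T 0 0 + T 0 1 * T 1 0 = z := by
    simpa [Matrix.mul_apply] using congrFun₂ h.sq 0 0
  have htrace : T 0 0 + T 1 1 = 0 := by simpa [moment] using h0
  have hdet := h.det_eq
  rw [Matrix.det_fin_two, prod_univ_eq_list_prod hs rfl] at hdet
  simp only [List.map_cons, List.map_nil, List.prod_cons, List.prod_nil, mul_one] at hdet
  linear_combination T 0 0 * htrace - hsq - hdet

theorem eval_mul_apply_self_two {T : Matrix (Fin 2) (Fin 2) K} {lam : Fin 2 → K} {o : Fin 2}
    (h : IsGenericBraidMatrix T lam z o) {r s : Fin 2} (hl : [r, s].Nodup) :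
    (polyP lam r).eval (lam r) * T r r = -(lam r ^ 2 * lam s ^ 2) := by
  obtain ⟨h0, h1, -⟩ := h.moments_two
  have hdiag := apply_self_mul_eq_moments T h.ne_zero 0 0 1 (-lam s) 0 (r := r) fun k hk => by
    obtain rfl : k = s := by simpa [hk] using mem_of_nodup_of_length_eq hl rfl k
    ring
  rw [h0, h1, prod_univ_eq_list_prod hl rfl] at hdiag
  rw [eval_polyP_eq_list_prod lam hl rfl]
  simp only [List.map_cons, List.map_nil, List.prod_cons, List.prod_nil, mul_one] at hdiag ⊢
  exact mul_left_cancel₀ (h.ne_zero r) (by linear_combination hdiag)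

theorem apply_mul_apply_two {T : Matrix (Fin 2) (Fin 2) K} {lam : Fin 2 → K} {o : Fin 2}
    (h : IsGenericBraidMatrix T lam z o) {r s : Fin 2} (hrs : r ≠ s) :
    (polyP lam r).eval (lam r) * (polyP lam s).eval (lam s) * (T r s * T s r) =
      polyQ2 (lam r) (lam s) * z := by
  have hl : [r, s].Nodup := by simpa using hrs
  have hl' : [s, r].Nodup := by simpa using hrs.symm
  have hdiag := h.eval_mul_apply_self_two hl
  have hwindow := h.apply_mul_apply_mul (α := 1) (β := 0) (κ := 0) hrs fun k h1 h2 => by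
    simpa [h1, h2] using mem_of_nodup_of_length_eq hl rfl k
  obtain ⟨-, -, hz⟩ := h.moments_two
  rw [prod_univ_eq_list_prod hl rfl] at hz
  rw [eval_polyP_eq_list_prod lam hl rfl] at hdiag ⊢
  rw [eval_polyP_eq_list_prod lam hl' rfl, polyQ2]
  simp only [List.map_cons, List.map_nil, List.prod_cons, List.prod_nil, mul_one] at hz hdiag ⊢
  have hT : T r s * T s r = z - T r r ^ 2 :=
    mul_left_cancel₀ (mul_ne_zero (pow_ne_zero 2 (h.ne_zero r)) (h.ne_zero s))
      (by linear_combination hwindow)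
  linear_combination (-(lam r - lam s) ^ 2) * hT +
    ((lam r - lam s) * T r r - lam r ^ 2 * lam s ^ 2) * hdiag + (lam r * lam s) * hz

theorem moments_three {T : Matrix (Fin 3) (Fin 3) K} {lam : Fin 3 → K} {o : Fin 3}
    (h : IsGenericBraidMatrix T lam z o) :
    moment T lam 0 = -∏ i, lam i ∧ moment T lam (-1) = 0 := by
  obtain ⟨s, k, hl⟩ : ∃ s k, [o, s, k].Nodup := by
    clear h
    revert o
    decide
  have window : ∀ s k, [o, s, k].Nodup →
      lam k * moment T lam (-1) - moment T lam 0 = ∏ i, lam i := by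
    intro s k hl
    have hos : o ≠ s := by
      rintro rfl
      simp at hl
    have hmom := h.moments_eq_of_apply_ne_zero (α := -1) (β := lam k) (κ := 0) hos
      (h.row_ne_zero s) fun i h1 h2 => by
        obtain rfl : i = k := by simpa [h1, h2] using mem_of_nodup_of_length_eq hl rfl i
        ring
    rw [prod_univ_eq_list_prod hl rfl]
    simp only [List.map_cons, List.map_nil, List.prod_cons, List.prod_nil, mul_one]
    exact mul_right_cancel₀ (mul_ne_zero (h.ne_zero o) (h.ne_zero s))
      (by linear_combination hmom)
  have hsk : lam s - lam k ≠ 0 := sub_ne_zero.2 (h.injective.ne (by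
    rintro rfl
    simp at hl))
  have hl' : [o, k, s].Nodup := (List.Perm.swap k s []).cons o |>.nodup hl
  have h1 : moment T lam (-1) = 0 :=
    (mul_eq_zero.1 (by linear_combination window k s hl' - window s k hl)).resolve_left hsk
  exact ⟨by linear_combination lam k * h1 - window s k hl, h1⟩

theorem scalar_eq_three {T : Matrix (Fin 3) (Fin 3) K} {lam : Fin 3 → K} {o : Fin 3}
    (h : IsGenericBraidMatrix T lam z o) : z = (∏ i, lam i) ^ 2 := by
  obtain ⟨hinv, -⟩ := h.inv.moments_three
  have hD := h.prod_ne_zero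
  have hz := h.scalar_ne_zero
  rw [moment_smul_inv, neg_zero, h.moments_three.1] at hinv
  simp only [Pi.inv_apply, Finset.prod_inv_distrib] at hinv
  field_simp at hinv
  exact neg_injective hinv.symm

theorem moment_one_three {T : Matrix (Fin 3) (Fin 3) K} {lam : Fin 3 → K} {o : Fin 3}
    (h : IsGenericBraidMatrix T lam z o) : moment T lam 1 = 0 := by
  obtain ⟨-, hinv⟩ := h.inv.moments_three
  rw [moment_smul_inv, neg_neg] at hinv
  exact (mul_eq_zero.1 hinv).resolve_left (inv_ne_zero h.scalar_ne_zero)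

theorem eval_mul_apply_self_three {T : Matrix (Fin 3) (Fin 3) K} {lam : Fin 3 → K} {o : Fin 3}
    (h : IsGenericBraidMatrix T lam z o) {r s k : Fin 3} (hl : [r, s, k].Nodup) :
    (polyP lam r).eval (lam r) * T r r =
      lam r * (lam s + lam k) * (lam r * (lam s * lam k)) := by
  obtain ⟨h0, h1⟩ := h.moments_three
  have hdiag := apply_self_mul_eq_moments T h.ne_zero 0 1 (-(lam s + lam k)) (lam s * lam k) 0
    (r := r) fun i hi => by
      obtain rfl | rfl : i = s ∨ i = k := by
        simpa [hi] using mem_of_nodup_of_length_eq hl rfl i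
      all_goals ring
  rw [h0, h1, h.moment_one_three, prod_univ_eq_list_prod hl rfl] at hdiag
  rw [eval_polyP_eq_list_prod lam hl rfl]
  simp only [List.map_cons, List.map_nil, List.prod_cons, List.prod_nil, mul_one] at hdiag ⊢
  exact mul_left_cancel₀ (h.ne_zero r) (by linear_combination hdiag)

theorem apply_mul_apply_three {T : Matrix (Fin 3) (Fin 3) K} {lam : Fin 3 → K} {o : Fin 3}
    (h : IsGenericBraidMatrix T lam z o) {r s k : Fin 3} (hl : [r, s, k].Nodup) :
    (polyP lam r).eval (lam r) * (polyP lam s).eval (lam s) * (T r s * T s r) =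
      polyQ3 (lam r) (lam s) (lam k) * z := by
  have hrs : r ≠ s := by
    rintro rfl
    simp at hl
  have hdiag := h.eval_mul_apply_self_three hl
  have hwindow := h.apply_mul_apply_mul (α := -lam k) (β := 0) (κ := 1) hrs fun i h1 h2 => by
    obtain rfl : i = k := by simpa [h1, h2] using mem_of_nodup_of_length_eq hl rfl i
    ring
  have hz := h.scalar_eq_three
  rw [prod_univ_eq_list_prod hl rfl] at hz
  rw [eval_polyP_eq_list_prod lam hl rfl] at hdiag ⊢
  rw [eval_polyP_eq_list_prod lam ((List.Perm.swap s r _).nodup hl) rfl, polyQ3]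
  simp only [List.map_cons, List.map_nil, List.prod_cons, List.prod_nil, mul_one] at hz hdiag ⊢
  have hT : lam r ^ 2 * (T r s * T s r * (lam s - lam k)) =
      z * T r r - lam k * z * lam r ^ 2 - T r r ^ 2 * lam r ^ 2 * (lam r - lam k) :=
    mul_left_cancel₀ (h.ne_zero s) (by linear_combination hwindow)
  refine mul_left_cancel₀ (pow_ne_zero 2 (h.ne_zero r)) ?_
  linear_combination ((lam r - lam s) * (lam r - lam k) * (lam s - lam r)) * hT +
    (lam r ^ 2 * ((lam r - lam s) * (lam r - lam k) * T r r +
      lam r * (lam s + lam k) * (lam r * (lam s * lam k))) - (lam r - lam s) * z) * hdiag -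
    lam r ^ 4 * (lam s + lam k) ^ 2 * hz

end IsGenericBraidMatrix

end LowDimension

section Kernels

variable {K : Type*} [Field K] {V : Type*} [AddCommGroup V] [Module K V]

theorem eigenspace_eq_ker (f : Module.End K V) (x : K) :
    f.eigenspace x = LinearMap.ker (aeval f (X - C x)) := by
  rw [Module.End.eigenspace_def, map_sub, aeval_X, aeval_C, Algebra.algebraMap_eq_smul_one]

variable [FiniteDimensional K V]

theorem finrank_map_add_finrank_inf_ker (f : Module.End K V) (W : Submodule K V) :
    Module.finrank K (W.map f) + Module.finrank K (W ⊓ LinearMap.ker f : Submodule K V) =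
      Module.finrank K W := by
  rw [← LinearMap.finrank_range_add_finrank_ker (f.domRestrict W), LinearMap.range_domRestrict,
    LinearMap.ker_domRestrict, ← Submodule.map_comap_subtype, Submodule.finrank_map_subtype_eq]

theorem finrank_ker_mul_le (f g : Module.End K V) :
    Module.finrank K (LinearMap.ker (f * g)) ≤
      Module.finrank K (LinearMap.ker f) + Module.finrank K (LinearMap.ker g) := by
  rw [← finrank_map_add_finrank_inf_ker g]
  refine add_le_add (Submodule.finrank_mono ?_) (Submodule.finrank_mono inf_le_right)
  rintro _ ⟨x, hx, rfl⟩
  exact hx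

theorem three_mul_finrank_range_sq_le {f : Module.End K V} (hf : f ^ 3 = 0) :
    3 * Module.finrank K (LinearMap.range (f ^ 2)) ≤ Module.finrank K V := by
  have hker : LinearMap.range (f ^ 2) ≤ LinearMap.ker f := by
    rw [LinearMap.range_le_ker_iff, ← Module.End.mul_eq_comp, ← pow_succ', hf]
  have hrange : LinearMap.range (f ^ 2) ≤ LinearMap.range f := by
    rw [pow_two, Module.End.mul_eq_comp]
    exact LinearMap.range_comp_le_range f f
  have hmap := finrank_map_add_finrank_inf_ker f (LinearMap.range f)
  rw [← LinearMap.range_comp, ← Module.End.mul_eq_comp, ← pow_two] at hmap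
  have hV := LinearMap.finrank_range_add_finrank_ker f
  have hinf := Submodule.finrank_mono (le_inf hrange hker)
  have := Submodule.finrank_mono hker
  omega

theorem finrank_le_natDegree_mul_of_finrank_eigenspace_le [IsAlgClosed K] {f : Module.End K V}
    {p : K[X]} (hp : p.Monic) (hf : aeval f p = 0) {k : ℕ}
    (hk : ∀ x, Module.finrank K (f.eigenspace x) ≤ k) :
    Module.finrank K V ≤ p.natDegree * k := by
  have hker (s : Multiset K) : Module.finrank K
      (LinearMap.ker (aeval f (s.map fun x => X - C x).prod)) ≤ s.card * k := by
    induction s using Multiset.induction_on with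
    | empty =>
      rw [Multiset.map_zero, Multiset.prod_zero, map_one, Module.End.one_eq_id, LinearMap.ker_id,
        finrank_bot]
      exact Nat.zero_le _
    | cons x s ih =>
      rw [Multiset.map_cons, Multiset.prod_cons, map_mul, Multiset.card_cons, add_one_mul,
        add_comm]
      refine (finrank_ker_mul_le _ _).trans (add_le_add ?_ ih)
      rw [← eigenspace_eq_ker]
      exact hk x
  have hsplits := IsAlgClosed.splits p
  have h := hker p.roots
  rw [← hsplits.eq_prod_roots_of_monic hp, hf, LinearMap.ker_zero, finrank_top,
    ← hsplits.natDegree_eq_card_roots] at h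
  exact h

theorem apply_mul_apply_comm_of_finrank_range_le_one {ι : Type*} [Fintype ι] [DecidableEq ι]
    {M : Matrix ι ι K} (h : Module.finrank K (LinearMap.range (Matrix.toLin' M)) ≤ 1) (r s : ι) :
    M r r * M s s = M r s * M s r := by
  obtain ⟨⟨x, _⟩, hx⟩ := finrank_le_one_iff.1 h
  have hcol (s : ι) : ∃ c : K, ∀ r, M r s = c * x r := by
    obtain ⟨c, hc⟩ := hx ⟨_, Pi.single s 1, rfl⟩
    refine ⟨c, fun r => ?_⟩
    simpa [Matrix.mulVec_single_one, eq_comm] using congrFun (congrArg Subtype.val hc) r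
  obtain ⟨a, ha⟩ := hcol r
  obtain ⟨b, hb⟩ := hcol s
  rw [ha r, ha s, hb r, hb s]
  ring

end Kernels

section Multiplicities

variable {K : Type*} [Field K] {V : Type*} [AddCommGroup V] [Module K V]
  [FiniteDimensional K V] {f : Module.End K V}

theorem mem_of_mem_roots_charpoly {S : Finset K} (hS : ∀ x, f.HasEigenvalue x → x ∈ S) {x : K}
    (hx : x ∈ f.charpoly.roots) : x ∈ S := by
  rw [mem_roots f.charpoly_monic.ne_zero, ← Module.End.hasEigenvalue_iff_isRoot_charpoly] at hx
  exact hS x hx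

theorem rootMultiplicity_eq_finrank_eigenspace {p : K[X]} (hp : aeval f p = 0)
    (hsq : Squarefree p) (x : K) :
    f.charpoly.rootMultiplicity x = Module.finrank K (f.eigenspace x) := by
  rw [← LinearMap.finrank_maxGenEigenspace_eq,
    (Module.End.isSemisimple_of_squarefree_aeval_eq_zero hsq hp
      ).isFinitelySemisimple.maxGenEigenspace_eq_eigenspace]

theorem pow_eq_of_hasEigenvalue {n : ℕ} {z x : K} (hf : aeval f (X ^ n - C z) = 0)
    (hx : f.HasEigenvalue x) : x ^ n = z := by
  have hroot := (Module.End.hasEigenvalue_iff_isRoot.1 hx).dvd (minpoly.dvd K f hf)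
  simpa [IsRoot, sub_eq_zero] using hroot

variable [IsAlgClosed K]

theorem sum_rootMultiplicity {S : Finset K} (hS : ∀ x, f.HasEigenvalue x → x ∈ S) :
    ∑ x ∈ S, f.charpoly.rootMultiplicity x = Module.finrank K V := by
  classical
  rw [Finset.sum_congr rfl fun x _ => (count_roots f.charpoly (a := x)).symm,
    Multiset.sum_count_eq_card fun x hx => mem_of_mem_roots_charpoly hS hx,
    splits_iff_card_roots.1 (IsAlgClosed.splits f.charpoly), f.charpoly_natDegree]

theorem trace_eq_sum_rootMultiplicity {S : Finset K} (hS : ∀ x, f.HasEigenvalue x → x ∈ S) :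
    LinearMap.trace K V f = ∑ x ∈ S, f.charpoly.rootMultiplicity x * x := by
  classical
  rw [Finset.sum_congr rfl fun x _ => by rw [← count_roots, ← nsmul_eq_mul],
    Module.End.trace_eq_sum_roots_charpoly_of_splits (IsAlgClosed.splits _)]
  exact Finset.sum_multiset_count_of_subset _ _ fun x hx =>
    mem_of_mem_roots_charpoly hS (Multiset.mem_toFinset.1 hx)

theorem det_eq_prod_rootMultiplicity {S : Finset K} (hS : ∀ x, f.HasEigenvalue x → x ∈ S) :
    LinearMap.det f = ∏ x ∈ S, x ^ f.charpoly.rootMultiplicity x := by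
  classical
  rw [Finset.prod_congr rfl fun x _ => by rw [← count_roots],
    Module.End.det_eq_prod_roots_charpoly_of_splits (IsAlgClosed.splits _)]
  exact Finset.prod_multiset_count_of_subset _ _ fun x hx =>
    mem_of_mem_roots_charpoly hS (Multiset.mem_toFinset.1 hx)

theorem trace_det_of_forall_hasEigenvalue_eq {t : K} (h : ∀ x, f.HasEigenvalue x → x = t) :
    LinearMap.trace K V f = Module.finrank K V * t ∧
      LinearMap.det f = t ^ Module.finrank K V := by
  have hS (x : K) (hx : f.HasEigenvalue x) : x ∈ ({t} : Finset K) :=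
    Finset.mem_singleton.2 (h x hx)
  have hsum := sum_rootMultiplicity hS
  rw [Finset.sum_singleton] at hsum
  rw [trace_eq_sum_rootMultiplicity hS, det_eq_prod_rootMultiplicity hS, Finset.sum_singleton,
    Finset.prod_singleton, hsum]
  exact ⟨rfl, rfl⟩

end Multiplicities

section SquareRoots

variable {K : Type*} [Field K] [IsAlgClosed K] {V : Type*} [AddCommGroup V] [Module K V]
  [FiniteDimensional K V] {f : Module.End K V}

theorem finrank_eigenspaces_of_sq (h2 : (2 : K) ≠ 0) {t : K} (ht : t ≠ 0)
    (hf : aeval f (X ^ 2 - C (t ^ 2)) = 0) :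
    Module.finrank K (f.eigenspace t) + Module.finrank K (f.eigenspace (-t)) =
        Module.finrank K V ∧
      LinearMap.trace K V f = Module.finrank K (f.eigenspace t) * t +
        Module.finrank K (f.eigenspace (-t)) * -t ∧
      LinearMap.det f = t ^ Module.finrank K (f.eigenspace t) *
        (-t) ^ Module.finrank K (f.eigenspace (-t)) := by
  classical
  have htt : t ≠ -t := fun h => mul_ne_zero h2 ht (by linear_combination h)
  have hS (x : K) (hx : f.HasEigenvalue x) : x ∈ ({t, -t} : Finset K) := by
    simpa using sq_eq_sq_iff_eq_or_eq_neg.1 (pow_eq_of_hasEigenvalue hf hx)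
  have hsq : Squarefree (X ^ 2 - C (t ^ 2) : K[X]) :=
    (separable_X_pow_sub_C (t ^ 2) (by exact_mod_cast h2) (pow_ne_zero 2 ht)).squarefree
  simp only [← rootMultiplicity_eq_finrank_eigenspace hf hsq]
  rw [← sum_rootMultiplicity hS, trace_eq_sum_rootMultiplicity hS,
    det_eq_prod_rootMultiplicity hS, Finset.sum_pair htt, Finset.sum_pair htt,
    Finset.prod_pair htt]
  exact ⟨rfl, rfl, rfl⟩

theorem trace_det_of_sq_of_two_eq_zero (h2 : (2 : K) = 0) {t : K}
    (hf : aeval f (X ^ 2 - C (t ^ 2)) = 0) :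
    LinearMap.trace K V f = Module.finrank K V * t ∧ LinearMap.det f = t ^ Module.finrank K V :=
  trace_det_of_forall_hasEigenvalue_eq fun x hx => by
    have hx := pow_eq_of_hasEigenvalue hf hx
    exact sub_eq_zero.1 (pow_eq_zero_iff two_ne_zero |>.1
      (by linear_combination hx + (t ^ 2 - x * t) * h2))

theorem det_eq_of_sq_of_trace_eq_zero (hV : Module.finrank K V = 4) {z : K} (hz : z ≠ 0)
    (hf : aeval f (X ^ 2 - C z) = 0) (htrace : LinearMap.trace K V f = 0) :
    LinearMap.det f = z ^ 2 := by
  obtain ⟨t, rfl⟩ := IsAlgClosed.exists_pow_nat_eq z two_pos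
  have ht : t ≠ 0 := pow_ne_zero_iff two_ne_zero |>.1 hz
  by_cases h2 : (2 : K) = 0
  · rw [(trace_det_of_sq_of_two_eq_zero h2 hf).2, hV]
    ring
  · obtain ⟨hsum, htr, hdet⟩ := finrank_eigenspaces_of_sq h2 ht hf
    rw [hdet]
    rw [htrace] at htr
    generalize Module.finrank K (f.eigenspace t) = a at *
    obtain rfl : a = 4 - Module.finrank K (f.eigenspace (-t)) := by omega
    generalize Module.finrank K (f.eigenspace (-t)) = b at *
    have hb : b ≤ 4 := by omega
    have h2t := mul_ne_zero h2 ht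
    have h4t := mul_ne_zero h2 h2t
    interval_cases b <;> push_cast at htr
    · exact (h4t (by linear_combination -htr)).elim
    · exact (h2t (by linear_combination -htr)).elim
    · ring
    · exact (h2t (by linear_combination htr)).elim
    · exact (h4t (by linear_combination htr)).elim

theorem exists_trace_det_of_sq (hV : Module.finrank K V = 5) {z : K} (hz : z ≠ 0)
    (hf : aeval f (X ^ 2 - C z) = 0) (hle : ∀ t, Module.finrank K (f.eigenspace t) ≤ 3) :
    ∃ t, t ^ 2 = z ∧ LinearMap.trace K V f = t ∧ LinearMap.det f = t ^ 5 := by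
  obtain ⟨t, rfl⟩ := IsAlgClosed.exists_pow_nat_eq z two_pos
  have ht : t ≠ 0 := pow_ne_zero_iff two_ne_zero |>.1 hz
  by_cases h2 : (2 : K) = 0
  · obtain ⟨htr, hdet⟩ := trace_det_of_sq_of_two_eq_zero h2 hf
    rw [hV] at htr hdet
    push_cast at htr
    exact ⟨t, rfl, by linear_combination htr + 2 * t * h2, hdet⟩
  · obtain ⟨hsum, htr, hdet⟩ := finrank_eigenspaces_of_sq h2 ht hf
    have hpos := hle t
    have hneg := hle (-t)
    rw [hV] at hsum
    generalize Module.finrank K (f.eigenspace t) = a at *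
    generalize Module.finrank K (f.eigenspace (-t)) = b at *
    obtain ⟨rfl, rfl⟩ | ⟨rfl, rfl⟩ : a = 3 ∧ b = 2 ∨ a = 2 ∧ b = 3 := by omega
    all_goals push_cast at htr
    · exact ⟨t, rfl, by linear_combination htr, by linear_combination hdet⟩
    · exact ⟨-t, by ring, by linear_combination htr, by linear_combination hdet⟩

end SquareRoots

section CubeRoots

theorem exists_eq_one_of_sum_eq_five {α : Type*} {S : Finset α} (hS : S.card = 3) {m : α → ℕ}
    (hm : ∀ x ∈ S, m x ≤ 2) (hsum : ∑ x ∈ S, m x = 5) :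
    ∃ u ∈ S, m u = 1 ∧ ∀ x ∈ S, x ≠ u → m x = 2 := by
  classical
  obtain ⟨u, hu, hlt⟩ : ∃ u ∈ S, m u < 2 := by
    by_contra! h
    have := Finset.sum_le_sum h
    rw [Finset.sum_const, hS, hsum] at this
    norm_num at this
  have herase : ∀ x ∈ S.erase u, m x ≤ 2 := fun x hx => hm x (Finset.mem_of_mem_erase hx)
  have hadd := Finset.add_sum_erase S m hu
  have hle := Finset.sum_le_sum herase
  rw [Finset.sum_const, Finset.card_erase_of_mem hu, hS, smul_eq_mul] at hle
  have heq : ∑ x ∈ S.erase u, m x = ∑ x ∈ S.erase u, 2 := by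
    rw [Finset.sum_const, Finset.card_erase_of_mem hu, hS, smul_eq_mul]
    omega
  rw [Finset.sum_eq_sum_iff_of_le herase] at heq
  exact ⟨u, hu, by omega, fun x hx hxu => heq x (Finset.mem_erase.2 ⟨hxu, hx⟩)⟩

theorem exists_finset_cube_roots {K : Type*} [Field K] [IsAlgClosed K] (h3 : (3 : K) ≠ 0) {z : K}
    (hz : z ≠ 0) :
    ∃ S : Finset K, (∀ x, x ∈ S ↔ x ^ 3 = z) ∧ S.card = 3 ∧ ∑ x ∈ S, x = 0 ∧ ∏ x ∈ S, x = z := by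
  have hmonic : (X ^ 3 - C z : K[X]).Monic := monic_X_pow_sub_C z three_ne_zero
  have hsplits := IsAlgClosed.splits (X ^ 3 - C z : K[X])
  have hdeg : (X ^ 3 - C z : K[X]).natDegree = 3 := natDegree_X_pow_sub_C
  have hnodup := nodup_roots (separable_X_pow_sub_C z (n := 3) (by exact_mod_cast h3) hz)
  have hsum : (X ^ 3 - C z : K[X]).roots.sum = 0 := by
    rw [← neg_eq_zero, ← hsplits.nextCoeff_eq_neg_sum_roots_of_monic hmonic,
      nextCoeff_of_natDegree_pos (by rw [hdeg]; exact three_pos), hdeg]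
    simp [coeff_X_pow]
  have hprod : (X ^ 3 - C z : K[X]).roots.prod = z := by
    have := hsplits.coeff_zero_eq_prod_roots_of_monic hmonic
    rw [hdeg, coeff_sub, coeff_X_pow, coeff_C_zero, if_neg three_ne_zero.symm] at this
    linear_combination this
  refine ⟨⟨_, hnodup⟩, fun x => ?_, ?_, ?_, ?_⟩
  · rw [Finset.mem_mk, mem_roots hmonic.ne_zero]
    simp [sub_eq_zero]
  · rw [Finset.card_mk, ← hsplits.natDegree_eq_card_roots, hdeg]
  · rw [Finset.sum_mk, Multiset.map_id', hsum]
  · rw [Finset.prod_mk, Multiset.map_id', hprod]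

variable {K : Type*} [Field K] {V : Type*} [AddCommGroup V] [Module K V]
  {f : Module.End K V}

theorem aeval_X_pow_three_sub_C_eq_mul (u : K) :
    aeval f (X - C u) * aeval f (X ^ 2 + C u * X + C (u ^ 2)) = aeval f (X ^ 3 - C (u ^ 3)) := by
  rw [← map_mul]
  congr 1
  simp only [C_pow]
  ring

variable [FiniteDimensional K V]

theorem finrank_range_le_finrank_eigenspace_of_cube {u : K}
    (hf : aeval f (X ^ 3 - C (u ^ 3)) = 0) :
    Module.finrank K (LinearMap.range (aeval f (X ^ 2 + C u * X + C (u ^ 2)))) ≤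
      Module.finrank K (f.eigenspace u) := by
  refine Submodule.finrank_mono ?_
  rw [eigenspace_eq_ker, LinearMap.range_le_ker_iff, ← Module.End.mul_eq_comp,
    aeval_X_pow_three_sub_C_eq_mul, hf]

variable [IsAlgClosed K]

theorem trace_det_of_cube_of_three_eq_zero (h3 : (3 : K) = 0) (hV : Module.finrank K V = 5) {u : K}
    (hf : aeval f (X ^ 3 - C (u ^ 3)) = 0) :
    LinearMap.trace K V f = -u ∧ LinearMap.det f = u ^ 5 ∧
      Module.finrank K (LinearMap.range (aeval f (X ^ 2 + C u * X + C (u ^ 2)))) ≤ 1 := by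
  have hC : (3 : K[X]) = 0 := by rw [← map_ofNat (C : K →+* K[X]) 3, h3, C_0]
  have hcube : (X ^ 3 - C (u ^ 3) : K[X]) = (X - C u) ^ 3 := by
    rw [C_pow]
    linear_combination (X ^ 2 * C u - X * C u ^ 2) * hC
  have hsq : (X ^ 2 + C u * X + C (u ^ 2) : K[X]) = (X - C u) ^ 2 := by
    rw [C_pow]
    linear_combination X * C u * hC
  obtain ⟨htr, hdet⟩ := trace_det_of_forall_hasEigenvalue_eq (f := f) (t := u) fun x hx => by
    have hx := pow_eq_of_hasEigenvalue hf hx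
    exact sub_eq_zero.1 (pow_eq_zero_iff three_ne_zero |>.1
      (by linear_combination hx + (x * u ^ 2 - x ^ 2 * u) * h3))
  rw [hV] at htr hdet
  push_cast at htr
  refine ⟨by linear_combination htr + 2 * u * h3, hdet, ?_⟩
  rw [hcube, map_pow] at hf
  have hrank := three_mul_finrank_range_sq_le hf
  rw [hsq, map_pow]
  omega

theorem exists_trace_det_of_cube_of_three_ne_zero (h3 : (3 : K) ≠ 0)
    (hV : Module.finrank K V = 5) {z : K} (hz : z ≠ 0) (hf : aeval f (X ^ 3 - C z) = 0)
    (hle : ∀ x, Module.finrank K (f.eigenspace x) ≤ 2) :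
    ∃ u, u ^ 3 = z ∧ LinearMap.trace K V f = -u ∧ LinearMap.det f = u ^ 5 ∧
      Module.finrank K (LinearMap.range (aeval f (X ^ 2 + C u * X + C (u ^ 2)))) ≤ 1 := by
  classical
  obtain ⟨S, hmem, hcard, hsum, hprod⟩ := exists_finset_cube_roots h3 hz
  have hS (x : K) (hx : f.HasEigenvalue x) : x ∈ S := (hmem x).2 (pow_eq_of_hasEigenvalue hf hx)
  have hsq := (separable_X_pow_sub_C z (n := 3) (by exact_mod_cast h3) hz).squarefree
  obtain ⟨u, hu, hu1, hne⟩ := exists_eq_one_of_sum_eq_five hcard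
    (m := fun x => f.charpoly.rootMultiplicity x) (fun x _ => by
      rw [rootMultiplicity_eq_finrank_eigenspace hf hsq]
      exact hle x) ((sum_rootMultiplicity hS).trans hV)
  have hu3 := (hmem u).1 hu
  have hu0 : u ≠ 0 := by
    rintro rfl
    exact hz (by rw [← hu3, zero_pow three_ne_zero])
  have hrest : ∀ x ∈ S.erase u, f.charpoly.rootMultiplicity x = 2 := fun x hx =>
    hne x (Finset.mem_of_mem_erase hx) (Finset.ne_of_mem_erase hx)
  rw [← Finset.add_sum_erase S _ hu] at hsum
  rw [← Finset.mul_prod_erase S _ hu] at hprod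
  refine ⟨u, hu3, ?_, ?_, ?_⟩
  · rw [trace_eq_sum_rootMultiplicity hS, ← Finset.add_sum_erase S _ hu, hu1,
      Finset.sum_congr rfl fun x hx => by rw [hrest x hx], ← Finset.mul_sum]
    push_cast
    linear_combination 2 * hsum
  · rw [det_eq_prod_rootMultiplicity hS, ← Finset.mul_prod_erase S _ hu, hu1,
      Finset.prod_congr rfl fun x hx => by rw [hrest x hx], Finset.prod_pow]
    rw [← hu3] at hprod
    have : ∏ x ∈ S.erase u, x = u ^ 2 := mul_left_cancel₀ hu0 (by linear_combination hprod)
    rw [this]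
    ring
  · subst hu3
    refine (finrank_range_le_finrank_eigenspace_of_cube hf).trans ?_
    rw [← rootMultiplicity_eq_finrank_eigenspace hf hsq]
    exact hu1.le

theorem exists_trace_det_of_cube (hV : Module.finrank K V = 5) {z : K} (hz : z ≠ 0)
    (hf : aeval f (X ^ 3 - C z) = 0) (hle : ∀ x, Module.finrank K (f.eigenspace x) ≤ 2) :
    ∃ u, u ^ 3 = z ∧ LinearMap.trace K V f = -u ∧ LinearMap.det f = u ^ 5 ∧
      Module.finrank K (LinearMap.range (aeval f (X ^ 2 + C u * X + C (u ^ 2)))) ≤ 1 := by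
  by_cases h3 : (3 : K) = 0
  · obtain ⟨u, rfl⟩ := IsAlgClosed.exists_pow_nat_eq z three_pos
    exact ⟨u, rfl, trace_det_of_cube_of_three_eq_zero h3 hV hf⟩
  · exact exists_trace_det_of_cube_of_three_ne_zero h3 hV hz hf hle

theorem exists_trace_det_of_disjoint (hV : Module.finrank K V = 5) {g : Module.End K V} {z : K}
    (hz : z ≠ 0) (hf : aeval f (X ^ 2 - C z) = 0) (hg : aeval g (X ^ 3 - C z) = 0)
    (hfg : ∀ t u, Disjoint (f.eigenspace t) (g.eigenspace u)) :
    (∃ t, t ^ 2 = z ∧ LinearMap.trace K V f = t ∧ LinearMap.det f = t ^ 5) ∧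
      ∃ u, u ^ 3 = z ∧ LinearMap.trace K V g = -u ∧ LinearMap.det g = u ^ 5 ∧
        Module.finrank K (LinearMap.range (aeval g (X ^ 2 + C u * X + C (u ^ 2)))) ≤ 1 := by
  have hadd (t u : K) :
      Module.finrank K (f.eigenspace t) + Module.finrank K (g.eigenspace u) ≤ 5 :=
    hV ▸ Submodule.finrank_add_finrank_le_of_disjoint (hfg t u)
  obtain ⟨t, ht⟩ : ∃ t, 3 ≤ Module.finrank K (f.eigenspace t) := by
    by_contra! h
    have := finrank_le_natDegree_mul_of_finrank_eigenspace_le (monic_X_pow_sub_C z two_ne_zero) hf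
      (k := 2) fun x => Nat.le_of_lt_succ (h x)
    rw [hV, natDegree_X_pow_sub_C] at this
    norm_num at this
  obtain ⟨u, hu⟩ : ∃ u, 2 ≤ Module.finrank K (g.eigenspace u) := by
    by_contra! h
    have := finrank_le_natDegree_mul_of_finrank_eigenspace_le
      (monic_X_pow_sub_C z three_ne_zero) hg (k := 1) fun x => Nat.le_of_lt_succ (h x)
    rw [hV, natDegree_X_pow_sub_C] at this
    norm_num at this
  exact ⟨exists_trace_det_of_sq hV hz hf fun x => by have := hadd x u; omega,
    exists_trace_det_of_cube hV hz hg fun x => by have := hadd t x; omega⟩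

end CubeRoots

section BraidMatrixSpectrum

variable {K : Type*} [Field K] {ι : Type*} [Fintype ι] [DecidableEq ι] {T : Matrix ι ι K}
  {lam : ι → K} {z : K}

/-- The matrix `U² + uU + u²`, where `U = T D⁻¹` is the matrix of `σ₁σ₂`. When `U³ = u³`,
it maps into the eigenspace of `U` for `u`, and outside characteristic three it is a multiple of the
projection onto that eigenspace. -/
def cubeRootProjection (T : Matrix ι ι K) (lam : ι → K) (u : K) : Matrix ι ι K :=
  (T * Matrix.diagonal lam⁻¹) ^ 2 + u • (T * Matrix.diagonal lam⁻¹) + u ^ 2 • 1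

namespace IsBraidMatrix

theorem aeval_toLin' (h : IsBraidMatrix T lam z) : aeval (Matrix.toLin' T) (X ^ 2 - C z) = 0 := by
  rw [map_sub, aeval_X_pow, aeval_C, Algebra.algebraMap_eq_smul_one, pow_two,
    Module.End.mul_eq_comp, ← Matrix.toLin'_mul, h.sq, map_smul, Matrix.toLin'_one,
    Module.End.one_eq_id, sub_self]

theorem mul_diagonal_inv_sq (h : IsBraidMatrix T lam z) :
    (T * Matrix.diagonal lam⁻¹) ^ 2 = Matrix.diagonal lam * T := by
  rw [pow_two, ← mul_assoc, h.rel, mul_assoc, h.diagonal_mul_inv, mul_one]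

theorem mul_diagonal_inv_cube (h : IsBraidMatrix T lam z) :
    (T * Matrix.diagonal lam⁻¹) ^ 3 = z • 1 := by
  rw [pow_succ, h.mul_diagonal_inv_sq, mul_assoc, ← mul_assoc T, h.sq, smul_mul_assoc, one_mul,
    mul_smul_comm, h.diagonal_mul_inv]

theorem aeval_toLin'_mul_diagonal_inv (h : IsBraidMatrix T lam z) :
    aeval (Matrix.toLin' (T * Matrix.diagonal lam⁻¹)) (X ^ 3 - C z) = 0 := by
  rw [map_sub, aeval_X_pow, aeval_C, Algebra.algebraMap_eq_smul_one, ← Matrix.toLin'_pow,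
    h.mul_diagonal_inv_cube, map_smul, Matrix.toLin'_one, Module.End.one_eq_id, sub_self]

/-- A common eigenvector of `σ₁σ₂σ₁` and `σ₁σ₂` is an eigenvector of `σ₁`, hence a multiple of a
basis vector. -/
theorem exists_apply_eq_zero (h : IsBraidMatrix T lam z) {x : ι → K} (hx0 : x ≠ 0) {t u : K}
    (hx : T.mulVec x = t • x) (hy : (T * Matrix.diagonal lam⁻¹).mulVec x = u • x) :
    ∃ r, ∀ s, s ≠ r → T s r = 0 := by
  obtain ⟨r, hr⟩ := Function.ne_iff.1 hx0
  have hdiag : z • (Matrix.diagonal lam⁻¹).mulVec x = (u * t) • x := by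
    rw [mul_smul, ← hx, ← Matrix.mulVec_smul T, ← hy, Matrix.mulVec_mulVec, ← mul_assoc, h.sq,
      smul_mul_assoc, one_mul, Matrix.smul_mulVec]
  have heigen (i : ι) (hi : x i ≠ 0) : z * (lam i)⁻¹ = u * t := by
    have := congrFun hdiag i
    simp only [Pi.smul_apply, Matrix.mulVec_diagonal, Pi.inv_apply, smul_eq_mul] at this
    exact mul_right_cancel₀ hi (by rw [← this, mul_assoc])
  have hsupp (i : ι) (hi : i ≠ r) : x i = 0 := by
    by_contra hxi
    exact hi (h.injective (inv_injective (mul_left_cancel₀ h.scalar_ne_zero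
      ((heigen i hxi).trans (heigen r hr).symm))))
  refine ⟨r, fun s hs => ?_⟩
  have := congrFun hx s
  rw [Matrix.mulVec, dotProduct, Fintype.sum_eq_single r fun i hi => by rw [hsupp i hi, mul_zero],
    Pi.smul_apply, hsupp s hs, smul_zero] at this
  exact (mul_eq_zero.1 this).resolve_right hr

theorem cubeRootProjection_apply_self (h : IsBraidMatrix T lam z) (u : K) (r : ι) :
    cubeRootProjection T lam u r r * lam r = T r r * (lam r ^ 2 + u) + u ^ 2 * lam r := by
  have hr := h.ne_zero r
  simp only [cubeRootProjection, h.mul_diagonal_inv_sq, Matrix.add_apply, Matrix.smul_apply,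
    Matrix.diagonal_mul, Matrix.mul_diagonal, Matrix.one_apply_eq, Pi.inv_apply, smul_eq_mul]
  field_simp

theorem cubeRootProjection_apply_of_ne (h : IsBraidMatrix T lam z) (u : K) {r s : ι}
    (hrs : r ≠ s) : cubeRootProjection T lam u r s * lam s = T r s * (u + lam r * lam s) := by
  have hs := h.ne_zero s
  simp only [cubeRootProjection, h.mul_diagonal_inv_sq, Matrix.add_apply, Matrix.smul_apply,
    Matrix.diagonal_mul, Matrix.mul_diagonal, Matrix.one_apply_ne hrs, Pi.inv_apply, smul_eq_mul]
  field_simp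
  ring

end IsBraidMatrix

theorem IsGenericBraidMatrix.disjoint_eigenspace [Nontrivial ι] {o : ι}
    (h : IsGenericBraidMatrix T lam z o) (t u : K) :
    Disjoint (Module.End.eigenspace (Matrix.toLin' T) t)
      (Module.End.eigenspace (Matrix.toLin' (T * Matrix.diagonal lam⁻¹)) u) := by
  rw [Submodule.disjoint_def]
  intro x hx hy
  rw [Module.End.mem_eigenspace_iff, Matrix.toLin'_apply] at hx hy
  by_contra hx0
  obtain ⟨r, hr⟩ := h.exists_apply_eq_zero hx0 hx hy
  by_cases hro : o = r
  · obtain ⟨s, hs⟩ := exists_ne r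
    exact h.col_ne_zero s (hro ▸ hr s hs)
  · exact h.row_ne_zero r (hr o hro)

end BraidMatrixSpectrum

section DimensionFour

variable {K : Type*} [Field K] {T : Matrix (Fin 4) (Fin 4) K} {lam : Fin 4 → K} {z : K} {o : Fin 4}

theorem polyQ4_identity {a b c e g : K} (hg : g ^ 2 = a * (b * (c * e))) :
    b * (b - a) * ((c + e) * g ^ 3 * ((a - b) * ((a - c) * (a - e))) -
        (c * e * a ^ 4 - g ^ 3) * ((b * c + b * e + c * e) * g + b * c * e * (b + c + e))) +
      b * a ^ 3 * ((b * c + b * e + c * e) * g + b * c * e * (b + c + e)) ^ 2 =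
    g ^ 2 * (a ^ 2 + g) * (b ^ 2 + g) * (g + a * c + b * e) * (g + a * e + b * c) := by
  grind

namespace IsGenericBraidMatrix

theorem window_four (h : IsGenericBraidMatrix T lam z o) {s k l : Fin 4}
    (hl : [o, s, k, l].Nodup) :
    (∏ i, lam i) * (lam k * lam l * moment T lam (-1) - (lam k + lam l) * moment T lam 0 +
      moment T lam 1) = (∏ i, lam i) ^ 2 + z * (lam k * lam l) := by
  have hos : o ≠ s := by
    rintro rfl
    simp at hl
  have hmom := h.moments_eq_of_apply_ne_zero (α := -(lam k + lam l)) (β := lam k * lam l) (κ := 1)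
    hos (h.row_ne_zero s) fun i h1 h2 => by
      obtain rfl | rfl : i = k ∨ i = l := by
        simpa [h1, h2] using mem_of_nodup_of_length_eq hl rfl i
      all_goals ring
  rw [prod_univ_eq_list_prod hl rfl]
  simp only [List.map_cons, List.map_nil, List.prod_cons, List.prod_nil, mul_one]
  linear_combination (lam k * lam l) * hmom

theorem moments_four (h : IsGenericBraidMatrix T lam z o) :
    moment T lam 0 = 0 ∧ (∏ i, lam i) * moment T lam (-1) = z ∧ moment T lam 1 = ∏ i, lam i := by
  obtain ⟨s, k, l, hl⟩ : ∃ s k l, [o, s, k, l].Nodup := by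
    clear h
    revert o
    decide
  have hD := h.prod_ne_zero
  have hw₁ := h.window_four hl
  have hw₂ := h.window_four (s := k) (k := s) (l := l) (by simp_all [eq_comm])
  have hw₃ := h.window_four (s := l) (k := s) (l := k) (by simp_all [eq_comm])
  simp only [List.nodup_cons, List.mem_cons, not_or] at hl
  have hsk : lam s - lam k ≠ 0 := sub_ne_zero.2 (h.injective.ne hl.2.1.1)
  have hsl : lam s - lam l ≠ 0 := sub_ne_zero.2 (h.injective.ne hl.2.1.2.1)
  have hkl : lam k - lam l ≠ 0 := sub_ne_zero.2 (h.injective.ne hl.2.2.1.1)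
  have hlin₁ : (∏ i, lam i) * (lam l * moment T lam (-1) - moment T lam 0) = z * lam l :=
    mul_left_cancel₀ hsk (by linear_combination hw₂ - hw₁)
  have hlin₂ : (∏ i, lam i) * (lam k * moment T lam (-1) - moment T lam 0) = z * lam k :=
    mul_left_cancel₀ hsl (by linear_combination hw₃ - hw₁)
  have hneg : (∏ i, lam i) * moment T lam (-1) = z :=
    mul_left_cancel₀ hkl (by linear_combination hlin₂ - hlin₁)
  have hzero : moment T lam 0 = 0 :=
    mul_left_cancel₀ hD (by linear_combination lam l * hneg - hlin₁)
  refine ⟨hzero, hneg, mul_left_cancel₀ hD ?_⟩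
  linear_combination hw₁ - lam k * lam l * hneg +
    (∏ i, lam i) * (lam k + lam l) * hzero

theorem exists_gamma_four [IsAlgClosed K] (h : IsGenericBraidMatrix T lam z o) :
    ∃ γ, γ ^ 4 = ∏ i, lam i ∧ z = -γ ^ 6 := by
  have htrace : LinearMap.trace K _ (Matrix.toLin' T) = 0 := by
    rw [Matrix.trace_toLin'_eq, ← h.moments_four.1]
    simp [moment, Matrix.trace]
  have hdet := det_eq_of_sq_of_trace_eq_zero
    (by rw [Module.finrank_fintype_fun_eq_card, Fintype.card_fin]) h.scalar_ne_zero h.aeval_toLin'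
    htrace
  rw [LinearMap.det_toLin', h.det_eq] at hdet
  have hD := h.prod_ne_zero
  obtain ⟨γ, hγ⟩ := IsAlgClosed.exists_pow_nat_eq (-z / ∏ i, lam i) two_pos
  have hγD : γ ^ 2 * ∏ i, lam i = -z := by rw [hγ, div_mul_cancel₀ _ hD]
  have hγ4 : γ ^ 4 = ∏ i, lam i := mul_right_cancel₀ (pow_ne_zero 2 hD)
    (by linear_combination (γ ^ 2 * ∏ i, lam i) * hγD - z * hγD - hdet)
  exact ⟨γ, hγ4, by linear_combination hγD + γ ^ 2 * hγ4⟩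

theorem eval_mul_apply_self_four (h : IsGenericBraidMatrix T lam z o) {γ : K}
    (hγ : γ ^ 4 = ∏ i, lam i) (hz : z = -γ ^ 6) {r s k l : Fin 4} (hl : [r, s, k, l].Nodup) :
    (polyP lam r).eval (lam r) * T r r =
      -(lam r ^ 2 * ((lam s * lam k + lam s * lam l + lam k * lam l) * γ ^ 2 +
        lam s * lam k * lam l * (lam s + lam k + lam l))) := by
  obtain ⟨h0, h1, h2⟩ := h.moments_four
  have hD := h.prod_ne_zero
  have hneg : moment T lam (-1) = -γ ^ 2 :=
    mul_left_cancel₀ hD (by rw [h1, hz, ← hγ]; ring)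
  have hdiag := apply_self_mul_eq_moments T h.ne_zero 0 1 (-(lam s + lam k + lam l))
    (lam s * lam k + lam s * lam l + lam k * lam l) (-(lam s * lam k * lam l)) (r := r)
    fun i hi => by
      obtain rfl | rfl | rfl : i = s ∨ i = k ∨ i = l := by
        simpa [hi] using mem_of_nodup_of_length_eq hl rfl i
      all_goals ring
  rw [h0, hneg, h2, h.moment_neg_two, prod_univ_eq_list_prod hl rfl, sum_univ_eq_list_sum hl rfl]
    at hdiag
  rw [eval_polyP_eq_list_prod lam hl rfl]
  simp only [List.map_cons, List.map_nil, List.prod_cons, List.prod_nil, mul_one, List.sum_cons,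
    List.sum_nil, add_zero] at hdiag ⊢
  linear_combination hdiag

theorem apply_mul_apply_four (h : IsGenericBraidMatrix T lam z o) {γ : K}
    (hγ : γ ^ 4 = ∏ i, lam i) (hz : z = -γ ^ 6) {r s k l : Fin 4} (hl : [r, s, k, l].Nodup) :
    (polyP lam r).eval (lam r) * (polyP lam s).eval (lam s) * (T r s * T s r) =
      polyQ4 γ (lam r) (lam s) (lam k) (lam l) * z := by
  have hrs : r ≠ s := by
    rintro rfl
    simp at hl
  have hdiag := h.eval_mul_apply_self_four hγ hz hl
  have hwindow := h.apply_mul_apply_mul (α := -(lam k + lam l)) (β := lam k * lam l) (κ := 1) hrs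
    fun i h1 h2 => by
      obtain rfl | rfl : i = k ∨ i = l := by
        simpa [h1, h2] using mem_of_nodup_of_length_eq hl rfl i
      all_goals ring
  have ha := h.ne_zero r
  have hγ0 : γ ≠ 0 := by
    rintro rfl
    exact h.prod_ne_zero (by rw [← hγ, zero_pow four_ne_zero])
  rw [prod_univ_eq_list_prod hl rfl] at hγ
  rw [eval_polyP_eq_list_prod lam hl rfl] at hdiag ⊢
  rw [eval_polyP_eq_list_prod lam ((List.Perm.swap s r _).nodup hl) rfl, polyQ4]
  simp only [List.map_cons, List.map_nil, List.prod_cons, List.prod_nil, mul_one] at hγ hdiag ⊢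
  have hidentity := polyQ4_identity (g := γ ^ 2) (by rw [← hγ]; ring)
  rw [hz] at hwindow ⊢
  generalize lam r = a at *
  generalize lam s = b at *
  generalize lam k = c at *
  generalize lam l = e at *
  set M := (b * c + b * e + c * e) * γ ^ 2 + b * c * e * (b + c + e)
  set P := (a - b) * ((a - c) * (a - e))
  have hQ : -(γ ^ 2)⁻¹ * (a ^ 2 + γ ^ 2) * (b ^ 2 + γ ^ 2) * (γ ^ 2 + a * c + b * e) *
      (γ ^ 2 + a * e + b * c) * -γ ^ 6 =
      (γ ^ 2) ^ 2 * (a ^ 2 + γ ^ 2) * (b ^ 2 + γ ^ 2) * (γ ^ 2 + a * c + b * e) *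
        (γ ^ 2 + a * e + b * c) := by
    field_simp
  rw [hQ]
  refine mul_left_cancel₀ (pow_ne_zero 2 ha) ?_
  linear_combination P * (b - a) * hwindow +
    (b * (b - a) * (c * e * a ^ 4 - γ ^ 6) + b * a * (P * T r r - a ^ 2 * M)) * hdiag +
    a ^ 2 * hidentity

end IsGenericBraidMatrix

end DimensionFour

section DimensionFive

variable {K : Type*} [Field K] {T : Matrix (Fin 5) (Fin 5) K} {lam : Fin 5 → K} {z : K} {o : Fin 5}

namespace IsBraidMatrix

theorem ne_zero_of_pow_five_eq (h : IsBraidMatrix T lam z) {γ : K} (hγ : γ ^ 5 = ∏ i, lam i) :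
    γ ≠ 0 := by
  rintro rfl
  exact h.prod_ne_zero (by rw [← hγ, zero_pow (by norm_num)])

theorem eq_of_pow_five_eq (h : IsBraidMatrix T lam z) {γ γ' : K} (hγ : γ ^ 5 = ∏ i, lam i)
    (hγ' : γ' ^ 5 = ∏ i, lam i) (hz : γ ^ 6 = γ' ^ 6) : γ = γ' :=
  mul_left_cancel₀ h.prod_ne_zero (by
    nth_rw 1 [← hγ]
    rw [← hγ', ← pow_succ, ← pow_succ, hz])

theorem moment_two_five (h : IsBraidMatrix T lam z) {γ : K} (hγ : γ ^ 5 = ∏ i, lam i)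
    (hz : z = γ ^ 6) {r k l m n : Fin 5} (hl : [r, k, l, m, n].Nodup) :
    moment T lam 2 = γ * (lam k * lam l * lam m * lam n +
      lam r * (lam k * lam l * lam m + lam k * lam l * lam n + lam k * lam m * lam n +
        lam l * lam m * lam n)) := by
  have hzγ : z = γ * ∏ i, lam i := by rw [hz, ← hγ, pow_succ' γ 5]
  have hr := h.ne_zero r
  have hk := h.ne_zero k
  have hl' := h.ne_zero l
  have hm := h.ne_zero m
  have hn := h.ne_zero n
  rw [h.moment_two, hzγ, prod_univ_eq_list_prod hl rfl, sum_univ_eq_list_sum hl rfl]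
  simp only [List.map_cons, List.map_nil, List.prod_cons, List.prod_nil, mul_one, List.sum_cons,
    List.sum_nil, add_zero]
  field_simp
  ring

end IsBraidMatrix

namespace IsGenericBraidMatrix

theorem exists_gamma_moments_five [IsAlgClosed K] (h : IsGenericBraidMatrix T lam z o) :
    ∃ γ, γ ^ 5 = ∏ i, lam i ∧ z = γ ^ 6 ∧ moment T lam 0 = γ ^ 3 ∧ moment T lam (-1) = -γ ^ 2 ∧
      ∀ r s, cubeRootProjection T lam (γ ^ 2) r r * cubeRootProjection T lam (γ ^ 2) s s =
        cubeRootProjection T lam (γ ^ 2) r s * cubeRootProjection T lam (γ ^ 2) s r := by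
  obtain ⟨⟨t, ht, htrace, hdet⟩, u, hu, htrace', hdet', hrank⟩ :=
    exists_trace_det_of_disjoint
      (by rw [Module.finrank_fintype_fun_eq_card, Fintype.card_fin]) h.scalar_ne_zero
      h.aeval_toLin' h.aeval_toLin'_mul_diagonal_inv h.disjoint_eigenspace
  rw [Matrix.trace_toLin'_eq] at htrace htrace'
  rw [LinearMap.det_toLin', h.det_eq] at hdet
  rw [LinearMap.det_toLin', Matrix.det_mul, h.det_eq] at hdet'
  have hu0 : u ≠ 0 := by
    rintro rfl
    exact h.scalar_ne_zero (by rw [← hu, zero_pow three_ne_zero])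
  have hγu : (t / u) ^ 2 = u := by
    field_simp
    rw [ht, hu]
  have hγt : (t / u) ^ 3 = t := by
    rw [pow_succ, hγu, mul_div_cancel₀ _ hu0]
  have hdet_sq : (∏ i, lam i) ^ 2 = u ^ 5 := by
    rw [← hdet']
    linear_combination -(∏ i, lam i) ^ 2 * h.det_diagonal_inv
  refine ⟨t / u, ?_, ?_, ?_, ?_, ?_⟩
  · rw [div_pow, ← hdet, ← hdet_sq]
    have := h.prod_ne_zero
    field_simp
  · rw [show 6 = 2 * 3 by rfl, pow_mul, hγu, hu]
  · rw [hγt, ← htrace]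
    simp [moment, Matrix.trace]
  · rw [hγu, ← htrace']
    simp [moment, Matrix.trace, Matrix.mul_diagonal]
  · have hprojection : Matrix.toLin' (cubeRootProjection T lam u) =
        aeval (Matrix.toLin' (T * Matrix.diagonal lam⁻¹)) (X ^ 2 + C u * X + C (u ^ 2)) := by
      simp only [cubeRootProjection, map_add, map_mul, aeval_X_pow, aeval_X, aeval_C,
        Algebra.algebraMap_eq_smul_one, map_smul, Matrix.toLin'_pow, Matrix.toLin'_one,
        Module.End.one_eq_id, smul_mul_assoc]
      rfl
    rw [hγu]
    exact apply_mul_apply_comm_of_finrank_range_le_one (by rwa [hprojection])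

theorem moments_five [IsAlgClosed K] (h : IsGenericBraidMatrix T lam z o) {γ : K}
    (hγ : γ ^ 5 = ∏ i, lam i) (hz : z = γ ^ 6) :
    moment T lam 0 = γ ^ 3 ∧ moment T lam (-1) = -γ ^ 2 ∧
      ∀ r s, cubeRootProjection T lam (γ ^ 2) r r * cubeRootProjection T lam (γ ^ 2) s s =
        cubeRootProjection T lam (γ ^ 2) r s * cubeRootProjection T lam (γ ^ 2) s r := by
  obtain ⟨γ', hγ', hz', hmoments⟩ := h.exists_gamma_moments_five
  rwa [h.eq_of_pow_five_eq hγ hγ' (hz.symm.trans hz')]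

theorem moment_one_five [IsAlgClosed K] (h : IsGenericBraidMatrix T lam z o) {γ : K}
    (hγ : γ ^ 5 = ∏ i, lam i) (hz : z = γ ^ 6) : moment T lam 1 = -γ ^ 4 := by
  have hγ0 := h.ne_zero_of_pow_five_eq hγ
  obtain ⟨-, hneg, -⟩ := h.inv.moments_five (γ := γ⁻¹)
    (by simp only [Pi.inv_apply, Finset.prod_inv_distrib, inv_pow, hγ]) (by rw [hz, inv_pow])
  rw [moment_smul_inv, neg_neg, hz] at hneg
  field_simp at hneg
  linear_combination hneg

theorem cubeRootProjection_apply_self_mul_eval [IsAlgClosed K] (h : IsGenericBraidMatrix T lam z o)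
    {γ : K} (hγ : γ ^ 5 = ∏ i, lam i) (hz : z = γ ^ 6) {r k l m n : Fin 5}
    (hl : [r, k, l, m, n].Nodup) :
    cubeRootProjection T lam (γ ^ 2) r r * (polyP lam r).eval (lam r) * (lam r * γ) =
      (γ ^ 2 + lam r * γ + lam r ^ 2) * ((γ ^ 2 + lam r * lam k) * (γ ^ 2 + lam r * lam l) *
        ((γ ^ 2 + lam r * lam m) * (γ ^ 2 + lam r * lam n))) := by
  have hr := h.ne_zero r
  have hprojection := h.cubeRootProjection_apply_self (γ ^ 2) r
  have hdiag := apply_self_mul_eq_moments T h.ne_zero 1 (-(lam k + lam l + lam m + lam n))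
    (lam k * lam l + lam k * lam m + lam k * lam n + lam l * lam m + lam l * lam n + lam m * lam n)
    (-(lam k * lam l * lam m + lam k * lam l * lam n + lam k * lam m * lam n +
      lam l * lam m * lam n)) (lam k * lam l * lam m * lam n) (r := r)
    fun i hi => by
      obtain rfl | rfl | rfl | rfl : i = k ∨ i = l ∨ i = m ∨ i = n := by
        simpa [hi] using mem_of_nodup_of_length_eq hl rfl i
      all_goals ring
  obtain ⟨h0, hneg, -⟩ := h.moments_five hγ hz
  rw [h.moment_two_five hγ hz hl, h.moment_one_five hγ hz, h0, hneg, h.moment_neg_two,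
    sum_univ_eq_list_sum hl rfl] at hdiag
  rw [prod_univ_eq_list_prod hl rfl] at hγ
  rw [eval_polyP_eq_list_prod lam hl rfl]
  simp only [List.map_cons, List.map_nil, List.prod_cons, List.prod_nil, mul_one, List.sum_cons,
    List.sum_nil, add_zero] at hdiag hγ ⊢
  generalize lam r = a at *
  generalize lam k = b at *
  generalize lam l = c at *
  generalize lam m = d at *
  generalize lam n = e at *
  refine mul_left_cancel₀ hr ?_
  linear_combination a * γ * ((a - b) * ((a - c) * ((a - d) * (a - e)))) * hprojection +
    a * γ * (a ^ 2 + γ ^ 2) * hdiag +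
    a * (-a * γ * (a ^ 2 + γ ^ 2) * (b + c + d + e) - a * γ ^ 4 - a ^ 2 * γ ^ 3 + a ^ 5 -
      γ ^ 5) * hγ

theorem apply_mul_apply_mul_sq_five [IsAlgClosed K] (h : IsGenericBraidMatrix T lam z o) {γ : K}
    (hγ : γ ^ 5 = ∏ i, lam i) (hz : z = γ ^ 6) {r s : Fin 5} (hrs : r ≠ s) :
    T r s * T s r * (γ ^ 2 + lam r * lam s) ^ 2 =
      lam r * lam s * (cubeRootProjection T lam (γ ^ 2) r r *
        cubeRootProjection T lam (γ ^ 2) s s) := by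
  rw [(h.moments_five hγ hz).2.2 r s]
  have hr := h.cubeRootProjection_apply_of_ne (γ ^ 2) hrs
  have hs := h.cubeRootProjection_apply_of_ne (γ ^ 2) hrs.symm
  linear_combination -(T s r * (γ ^ 2 + lam r * lam s)) * hr -
    cubeRootProjection T lam (γ ^ 2) r s * lam s * hs

theorem add_mul_ne_zero_five [IsAlgClosed K] (h : IsGenericBraidMatrix T lam z o) {γ : K}
    (hγ : γ ^ 5 = ∏ i, lam i) (hz : z = γ ^ 6) {r s : Fin 5} (hrs : r ≠ s) :
    γ ^ 2 + lam r * lam s ≠ 0 := by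
  have hγ0 := h.ne_zero_of_pow_five_eq hγ
  intro h0
  have hdiag {r s : Fin 5} (hrs : r ≠ s) (h0 : γ ^ 2 + lam r * lam s = 0) :
      cubeRootProjection T lam (γ ^ 2) r r = 0 := by
    obtain ⟨k, l, m, hl⟩ : ∃ k l m, [r, s, k, l, m].Nodup := by
      clear * - hrs
      revert r s
      decide
    have := h.cubeRootProjection_apply_self_mul_eval hγ hz hl
    rw [h0, zero_mul, zero_mul, mul_zero] at this
    simpa [h.ne_zero r, hγ0, eval_polyP_self_ne_zero h.injective r] using this
  have hoff {r s q : Fin 5} (hrs : r ≠ s) (h0 : γ ^ 2 + lam r * lam s = 0) (hqr : q ≠ r)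
      (hqs : q ≠ s) : T r q * T q r = 0 := by
    have := h.apply_mul_apply_mul_sq_five hγ hz hqr.symm
    rw [hdiag hrs h0, zero_mul, mul_zero] at this
    refine (mul_eq_zero.1 this).resolve_right (pow_ne_zero 2 fun hq => hqs ?_)
    exact h.injective (mul_left_cancel₀ (h.ne_zero r) (by linear_combination hq - h0))
  have h0' : γ ^ 2 + lam s * lam r = 0 := by rw [mul_comm, h0]
  obtain ⟨q, hqr, hqs⟩ : ∃ q, q ≠ r ∧ q ≠ s := by
    clear * -
    revert r s
    decide
  by_cases hro : r = o
  · subst hro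
    exact mul_ne_zero (h.row_ne_zero q) (h.col_ne_zero q) (hoff hrs h0 hqr hqs)
  by_cases hso : s = o
  · subst hso
    exact mul_ne_zero (h.row_ne_zero q) (h.col_ne_zero q) (hoff hrs.symm h0' hqs hqr)
  · exact mul_ne_zero (h.col_ne_zero r) (h.row_ne_zero r)
      (hoff hrs h0 (Ne.symm hro) (Ne.symm hso))

theorem apply_mul_apply_five [IsAlgClosed K] (h : IsGenericBraidMatrix T lam z o) {γ : K}
    (hγ : γ ^ 5 = ∏ i, lam i) (hz : z = γ ^ 6) {r s k l m : Fin 5} (hl : [r, s, k, l, m].Nodup) :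
    (polyP lam r).eval (lam r) * (polyP lam s).eval (lam s) * (T r s * T s r) =
      polyQ5 γ (lam r) (lam s) (lam k) (lam l) (lam m) * z := by
  have hrs : r ≠ s := by
    rintro rfl
    simp at hl
  have hdiag_r := h.cubeRootProjection_apply_self_mul_eval hγ hz hl
  have hdiag_s := h.cubeRootProjection_apply_self_mul_eval hγ hz ((List.Perm.swap s r _).nodup hl)
  have hoff := h.apply_mul_apply_mul_sq_five hγ hz hrs
  have hγ0 := h.ne_zero_of_pow_five_eq hγ
  refine mul_right_cancel₀ (pow_ne_zero 2 (h.add_mul_ne_zero_five hγ hz hrs)) ?_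
  rw [polyQ5, hz]
  generalize (polyP lam r).eval (lam r) = p at *
  generalize (polyP lam s).eval (lam s) = q at *
  generalize cubeRootProjection T lam (γ ^ 2) r r = v at *
  generalize cubeRootProjection T lam (γ ^ 2) s s = w at *
  calc p * q * (T r s * T s r) * (γ ^ 2 + lam r * lam s) ^ 2
      = p * q * (T r s * T s r * (γ ^ 2 + lam r * lam s) ^ 2) := by ring
    _ = (v * p * (lam r * γ)) * (w * q * (lam s * γ)) / γ ^ 2 := by
      rw [hoff]
      field_simp
    _ = _ := by
      rw [hdiag_r, hdiag_s]
      field_simp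

end IsGenericBraidMatrix

end DimensionFive

section DiagonalEndomorphisms

variable {K : Type*} [Field K] {V : Type*} [AddCommGroup V] [Module K V] {ι : Type*}
  {f : Module.End K V} {b : Module.Basis ι K V} {lam : ι → K}

theorem toMatrix_eq_diagonal [Fintype ι] [DecidableEq ι] (h : ∀ i, f (b i) = lam i • b i) :
    LinearMap.toMatrix b b f = Matrix.diagonal lam := by
  ext i j
  rw [LinearMap.toMatrix_apply, h, map_smul, Module.Basis.repr_self, Finsupp.smul_apply,
    Finsupp.single_apply, Matrix.diagonal_apply]
  rcases eq_or_ne i j with rfl | hij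
  · rw [if_pos rfl, if_pos rfl, smul_eq_mul, mul_one]
  · rw [if_neg hij, if_neg hij.symm, smul_zero]

theorem repr_apply_of_apply_eq_smul (h : ∀ i, f (b i) = lam i • b i) (x : V) (i : ι) :
    b.repr (f x) i = lam i * b.repr x i := by
  classical
  have hcoord : b.coord i ∘ₗ f = lam i • b.coord i := b.ext fun j => by
    rcases eq_or_ne j i with rfl | hij <;> simp [*]
  exact LinearMap.congr_fun hcoord x

theorem hasEigenvalue_iff_of_apply_eq_smul [Finite ι] (h : ∀ i, f (b i) = lam i • b i) (μ : K) :
    f.HasEigenvalue μ ↔ ∃ i, μ = lam i := by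
  classical
  have := Fintype.ofFinite ι
  rw [← Matrix.toLin_toMatrix b b f, toMatrix_eq_diagonal h, hasEigenvalue_toLin_diagonal_iff]
  simp only [eq_comm]

theorem maxGenEigenspace_eq_span_singleton (hlam : Function.Injective lam)
    (h : ∀ i, f (b i) = lam i • b i) (i : ι) : f.maxGenEigenspace (lam i) = K ∙ b i := by
  refine le_antisymm (fun x hx => ?_) ?_
  · obtain ⟨k, hk⟩ := (Module.End.mem_maxGenEigenspace _ _ _).1 hx
    have hpow (j : ι) : ((f - lam i • (1 : Module.End K V)) ^ k) (b j) =
        (lam j - lam i) ^ k • b j := by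
      have := Module.End.aeval_apply_of_mem_apply_eq_smul (p := (X - C (lam i)) ^ k) (h j)
      simpa [Algebra.algebraMap_eq_smul_one] using this
    have hzero (j : ι) (hj : j ≠ i) : b.repr x j = 0 := by
      have := repr_apply_of_apply_eq_smul (lam := fun j => (lam j - lam i) ^ k) hpow x j
      rw [hk, map_zero, Finsupp.zero_apply] at this
      exact (mul_eq_zero.1 this.symm).resolve_left (pow_ne_zero _ (sub_ne_zero.2 (hlam.ne hj)))
    have hx : b.repr x = Finsupp.single i (b.repr x i) := by
      ext j
      rcases eq_or_ne j i with rfl | hj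
      · rw [Finsupp.single_eq_same]
      · rw [hzero j hj, Finsupp.single_eq_of_ne hj]
    exact Submodule.mem_span_singleton.2 ⟨b.repr x i, by
      rw [← b.repr_symm_single, ← hx, LinearEquiv.symm_apply_apply]⟩
  · rw [Submodule.span_singleton_le_iff_mem, Module.End.mem_maxGenEigenspace]
    exact ⟨1, by simp [h]⟩

theorem finrank_maxGenEigenspace_eq_one (hlam : Function.Injective lam)
    (h : ∀ i, f (b i) = lam i • b i) (i : ι) :
    Module.finrank K (f.maxGenEigenspace (lam i)) = 1 := by
  rw [maxGenEigenspace_eq_span_singleton hlam h]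
  exact finrank_span_singleton (b.ne_zero i)

end DiagonalEndomorphisms

section SimpleSpectrum

variable {K : Type*} [Field K] {V : Type*} [AddCommGroup V] [Module K V] {d : ℕ}
  {f : Module.End K V} {b : Module.Basis (Fin d) K V} {lam : Fin d → K}

theorem aeval_polyP_apply (h : ∀ i, f (b i) = lam i • b i) (r : Fin d) (x : V) :
    aeval f (polyP lam r) x = ((polyP lam r).eval (lam r) * b.repr x r) • b r := by
  conv_lhs => rw [← b.sum_repr x]
  rw [map_sum, Fintype.sum_eq_single r]
  · rw [map_smul, Module.End.aeval_apply_of_mem_apply_eq_smul (h r), smul_smul, mul_comm]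
  · intro i hi
    rw [map_smul, Module.End.aeval_apply_of_mem_apply_eq_smul (h i), eval_polyP_of_ne lam hi,
      zero_smul, smul_zero]

theorem aeval_polyP_ne_zero (hlam : Function.Injective lam) (h : ∀ i, f (b i) = lam i • b i)
    (r : Fin d) : aeval f (polyP lam r) ≠ 0 := by
  intro h0
  have := aeval_polyP_apply h r (b r)
  rw [h0, LinearMap.zero_apply, Module.Basis.repr_self, Finsupp.single_eq_same, mul_one] at this
  exact smul_ne_zero (eval_polyP_self_ne_zero hlam r) (b.ne_zero r) this.symm

theorem basis_mem_of_repr_ne_zero (hlam : Function.Injective lam)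
    (h : ∀ i, f (b i) = lam i • b i) {W : Submodule K V} (hW : W ≤ W.comap f) {x : V} (hx : x ∈ W)
    {i : Fin d} (hi : b.repr x i ≠ 0) : b i ∈ W := by
  have hmem := aeval_apply_smul_mem_of_le_comap hx (polyP lam i) f hW
  rw [aeval_polyP_apply h] at hmem
  exact (W.smul_mem_iff (mul_ne_zero (eval_polyP_self_ne_zero hlam i) hi)).1 hmem

end SimpleSpectrum

section BraidRepresentations

theorem braidGen_rel :
    braidGen 0 * braidGen 1 * braidGen 0 = braidGen 1 * braidGen 0 * braidGen 1 :=
  mul_inv_eq_one.1 (PresentedGroup.one_of_mem (rels := braidRels) (Set.mem_singleton _))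

/-- The half twist `σ₁σ₂σ₁`, which conjugates `σ₁` into `σ₂` and whose square is central. -/
def halfTwist : B3 := braidGen 0 * braidGen 1 * braidGen 0

theorem halfTwist_mul_zero : halfTwist * braidGen 0 = braidGen 1 * halfTwist := by
  rw [halfTwist]
  nth_rw 1 [braidGen_rel]
  simp only [mul_assoc]

theorem halfTwist_mul_one : halfTwist * braidGen 1 = braidGen 0 * halfTwist := by
  rw [halfTwist]
  nth_rw 2 [braidGen_rel]
  simp only [mul_assoc]

theorem halfTwist_sq_mul_zero : halfTwist ^ 2 * braidGen 0 = braidGen 0 * halfTwist ^ 2 := by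
  rw [pow_two, mul_assoc, halfTwist_mul_zero, ← mul_assoc, halfTwist_mul_one, mul_assoc]

theorem mul_aeval_of_mul_eq {K R : Type*} [CommRing K] [Ring R] [Algebra K R] {t a b : R}
    (h : t * a = b * t) (p : K[X]) : t * aeval a p = aeval b p * t := by
  induction p using Polynomial.induction_on' with
  | add p q hp hq => rw [map_add, map_add, mul_add, add_mul, hp, hq]
  | monomial n x =>
    rw [aeval_monomial, aeval_monomial, ← mul_assoc, ← Algebra.commutes, mul_assoc, mul_assoc,
      (show SemiconjBy t a b from h).pow_right n]

variable {K : Type w} [Field K] {V : Type v} [AddCommGroup V] [Module K V] {d : ℕ}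
  (ρ : Representation K B3 V)

theorem aeval_braidGen_one (p : K[X]) :
    aeval (ρ (braidGen 1)) p = ρ halfTwist * aeval (ρ (braidGen 0)) p * ρ halfTwist⁻¹ := by
  have hconj : ρ halfTwist * ρ (braidGen 0) = ρ (braidGen 1) * ρ halfTwist := by
    rw [← map_mul, ← map_mul, halfTwist_mul_zero]
  rw [mul_aeval_of_mul_eq hconj, mul_assoc, ← map_mul, mul_inv_cancel, map_one, mul_one]

theorem aeval_braidGen_zero (p : K[X]) :
    aeval (ρ (braidGen 0)) p = ρ halfTwist * aeval (ρ (braidGen 1)) p * ρ halfTwist⁻¹ := by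
  have hconj : ρ halfTwist * ρ (braidGen 1) = ρ (braidGen 0) * ρ halfTwist := by
    rw [← map_mul, ← map_mul, halfTwist_mul_one]
  rw [mul_aeval_of_mul_eq hconj, mul_assoc, ← map_mul, mul_inv_cancel, map_one, mul_one]

theorem aeval_mul_aeval_mul_aeval_conj (p q : K[X]) :
    aeval (ρ (braidGen 1)) p * aeval (ρ (braidGen 0)) q * aeval (ρ (braidGen 1)) p =
      ρ halfTwist * (aeval (ρ (braidGen 0)) p * aeval (ρ (braidGen 1)) q *
        aeval (ρ (braidGen 0)) p) * ρ halfTwist⁻¹ := by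
  have hinv : ρ halfTwist⁻¹ * ρ halfTwist = 1 := by rw [← map_mul, inv_mul_cancel, map_one]
  rw [aeval_braidGen_one ρ p, aeval_braidGen_zero ρ q]
  simp only [mul_assoc, ← mul_assoc (ρ halfTwist⁻¹) (ρ halfTwist), hinv, one_mul]

/-- The matrix of the half twist in a basis. -/
def twistMatrix (b : Module.Basis (Fin d) K V) : Matrix (Fin d) (Fin d) K :=
  LinearMap.toMatrix b b (ρ halfTwist)

variable {ρ} {b : Module.Basis (Fin d) K V}

theorem repr_halfTwist (r s : Fin d) : b.repr (ρ halfTwist (b s)) r = twistMatrix ρ b r s := by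
  rw [twistMatrix, LinearMap.toMatrix_apply]

theorem toMatrix_halfTwist_inv : LinearMap.toMatrix b b (ρ halfTwist⁻¹) = (twistMatrix ρ b)⁻¹ :=
  (Matrix.inv_eq_left_inv (by
    rw [twistMatrix, ← LinearMap.toMatrix_mul, ← map_mul, inv_mul_cancel, map_one,
      LinearMap.toMatrix_one])).symm

theorem repr_halfTwist_inv (r s : Fin d) :
    b.repr (ρ halfTwist⁻¹ (b r)) s = (twistMatrix ρ b)⁻¹ s r := by
  rw [← toMatrix_halfTwist_inv, LinearMap.toMatrix_apply]

theorem isUnit_det_twistMatrix : IsUnit (twistMatrix ρ b).det :=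
  (Matrix.isUnit_iff_isUnit_det _).1 (IsUnit.of_mul_eq_one (LinearMap.toMatrix b b (ρ halfTwist⁻¹))
    (by rw [twistMatrix, ← LinearMap.toMatrix_mul, ← map_mul, mul_inv_cancel, map_one,
      LinearMap.toMatrix_one]))

/-- A representation of the braid group with a basis of eigenvectors of `σ₁` for distinct
eigenvalues. -/
structure IsDiagonalBraidRep (ρ : Representation K B3 V) (b : Module.Basis (Fin d) K V)
    (lam : Fin d → K) : Prop where
  apply_basis : ∀ i, ρ (braidGen 0) (b i) = lam i • b i
  injective : Function.Injective lam

/-- A diagonal braid group representation in which one eigenline of `σ₂` is in general position to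
all eigenlines of `σ₁`. Up to nonzero scalars, `P_i(σ_j)` is the projection of `V` onto the
eigenline of `σ_j` for `λ_i`. -/
structure IsGenericBraidRep (ρ : Representation K B3 V) (b : Module.Basis (Fin d) K V)
    (lam : Fin d → K) (o : Fin d) : Prop extends IsDiagonalBraidRep ρ b lam where
  compress_ne_zero : ∀ i, aeval (ρ (braidGen 1)) (polyP lam o) *
    aeval (ρ (braidGen 0)) (polyP lam i) * aeval (ρ (braidGen 1)) (polyP lam o) ≠ 0

/-- The scalars `Q_{rs}`, in terms of the matrix of the half twist. -/
def qFamily (ρ : Representation K B3 V) (b : Module.Basis (Fin d) K V) (lam : Fin d → K)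
    (r s : Fin d) : K :=
  (polyP lam r).eval (lam r) * (polyP lam s).eval (lam s) *
    (twistMatrix ρ b r s * (twistMatrix ρ b)⁻¹ s r)

namespace IsDiagonalBraidRep

variable {lam : Fin d → K}

theorem ne_zero (h : IsDiagonalBraidRep ρ b lam) (i : Fin d) : lam i ≠ 0 := by
  intro h0
  apply b.ne_zero i
  calc b i = ρ ((braidGen 0)⁻¹ * braidGen 0) (b i) := by
        rw [inv_mul_cancel, map_one, Module.End.one_apply]
    _ = 0 := by rw [map_mul, Module.End.mul_apply, h.apply_basis, h0, zero_smul, map_zero]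

theorem compress_zero (h : IsDiagonalBraidRep ρ b lam) (r s : Fin d) :
    aeval (ρ (braidGen 0)) (polyP lam r) * aeval (ρ (braidGen 1)) (polyP lam s) *
      aeval (ρ (braidGen 0)) (polyP lam r) =
        qFamily ρ b lam r s • aeval (ρ (braidGen 0)) (polyP lam r) := by
  ext x
  rw [aeval_braidGen_one]
  simp only [Module.End.mul_apply, LinearMap.smul_apply, aeval_polyP_apply h.apply_basis, map_smul,
    Finsupp.smul_apply, smul_eq_mul, repr_halfTwist, repr_halfTwist_inv, smul_smul, qFamily]
  congr 1
  ring

theorem compress_one (h : IsDiagonalBraidRep ρ b lam) (r s : Fin d) :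
    aeval (ρ (braidGen 1)) (polyP lam r) * aeval (ρ (braidGen 0)) (polyP lam s) *
      aeval (ρ (braidGen 1)) (polyP lam r) =
        qFamily ρ b lam r s • aeval (ρ (braidGen 1)) (polyP lam r) := by
  rw [aeval_mul_aeval_mul_aeval_conj, h.compress_zero, mul_smul_comm, smul_mul_assoc,
    ← aeval_braidGen_one]

theorem exists_basis_braidGen (h : IsDiagonalBraidRep ρ b lam) (j : Fin 2) :
    ∃ b' : Module.Basis (Fin d) K V, ∀ i, ρ (braidGen j) (b' i) = lam i • b' i := by
  fin_cases j
  · exact ⟨b, h.apply_basis⟩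
  · let e : V ≃ₗ[K] V := LinearEquiv.ofLinearMap (ρ halfTwist) (ρ halfTwist⁻¹)
      (by rw [← Module.End.mul_eq_comp, ← map_mul, mul_inv_cancel, map_one, Module.End.one_eq_id])
      (by rw [← Module.End.mul_eq_comp, ← map_mul, inv_mul_cancel, map_one, Module.End.one_eq_id])
    refine ⟨b.map e, fun i => ?_⟩
    change ρ (braidGen 1) (ρ halfTwist (b i)) = lam i • ρ halfTwist (b i)
    rw [← Module.End.mul_apply, ← map_mul, ← halfTwist_mul_zero, map_mul, Module.End.mul_apply,
      h.apply_basis, map_smul]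

theorem aeval_braidGen_one_ne_zero (h : IsDiagonalBraidRep ρ b lam) (r : Fin d) :
    aeval (ρ (braidGen 1)) (polyP lam r) ≠ 0 := by
  obtain ⟨b', hb'⟩ := h.exists_basis_braidGen 1
  exact aeval_polyP_ne_zero h.injective hb' r

theorem qFamily_eq_of_compress_one (h : IsDiagonalBraidRep ρ b lam) {r s : Fin d} {q : K}
    (hq : aeval (ρ (braidGen 1)) (polyP lam r) * aeval (ρ (braidGen 0)) (polyP lam s) *
      aeval (ρ (braidGen 1)) (polyP lam r) = q • aeval (ρ (braidGen 1)) (polyP lam r)) :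
    qFamily ρ b lam r s = q :=
  smul_left_injective K (h.aeval_braidGen_one_ne_zero r) ((h.compress_one r s).symm.trans hq)

theorem twistMatrix_rel (h : IsDiagonalBraidRep ρ b lam) :
    twistMatrix ρ b * Matrix.diagonal lam⁻¹ * twistMatrix ρ b =
      Matrix.diagonal lam * twistMatrix ρ b * Matrix.diagonal lam := by
  have hdiag : Matrix.diagonal lam * Matrix.diagonal lam⁻¹ = 1 := by
    simp [Matrix.diagonal_mul_diagonal, h.ne_zero]
  have htwist : twistMatrix ρ b = Matrix.diagonal lam *
      LinearMap.toMatrix b b (ρ (braidGen 1)) * Matrix.diagonal lam := by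
    rw [← toMatrix_eq_diagonal h.apply_basis, ← LinearMap.toMatrix_mul, ← LinearMap.toMatrix_mul,
      ← map_mul, ← map_mul, twistMatrix, halfTwist]
  have hconj : LinearMap.toMatrix b b (ρ (braidGen 1)) * twistMatrix ρ b =
      twistMatrix ρ b * Matrix.diagonal lam := by
    rw [← toMatrix_eq_diagonal h.apply_basis, twistMatrix, ← LinearMap.toMatrix_mul,
      ← LinearMap.toMatrix_mul, ← map_mul, ← map_mul, halfTwist_mul_zero]
  nth_rw 1 [htwist]
  rw [mul_assoc _ (Matrix.diagonal lam) (Matrix.diagonal lam⁻¹), hdiag, mul_one, mul_assoc, hconj,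
    mul_assoc]

theorem twistMatrix_sq_commute (h : IsDiagonalBraidRep ρ b lam) :
    Commute (twistMatrix ρ b ^ 2) (Matrix.diagonal lam) := by
  rw [Commute, SemiconjBy, ← toMatrix_eq_diagonal h.apply_basis, twistMatrix, pow_two,
    ← LinearMap.toMatrix_mul, ← map_mul ρ, ← LinearMap.toMatrix_mul, ← LinearMap.toMatrix_mul,
    ← map_mul ρ, ← map_mul ρ, ← pow_two, halfTwist_sq_mul_zero]

end IsDiagonalBraidRep

end BraidRepresentations

section GenericBraidRep

theorem eq_smul_one_of_commute {K ι : Type*} [Field K] [Fintype ι] [DecidableEq ι]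
    {N T : Matrix ι ι K} {lam : ι → K} (hlam : Function.Injective lam)
    (hN : Commute N (Matrix.diagonal lam)) (hT : Commute N T) {o : ι} (ho : ∀ s, T o s ≠ 0) :
    N = N o o • 1 := by
  have hoff (i j : ι) (hij : i ≠ j) : N i j = 0 := by
    have := congrFun (congrFun hN.eq i) j
    rw [Matrix.mul_diagonal, Matrix.diagonal_mul] at this
    exact (mul_eq_zero.1 (by linear_combination this : N i j * (lam j - lam i) = 0)).resolve_right
      (sub_ne_zero.2 (hlam.ne hij.symm))
  have hdiag (i : ι) : N i i = N o o := by
    have := congrFun (congrFun hT.eq o) i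
    rw [Matrix.mul_apply, Matrix.mul_apply,
      Fintype.sum_eq_single o fun j hj => by rw [hoff o j hj.symm, zero_mul],
      Fintype.sum_eq_single i fun j hj => by rw [hoff j i hj, mul_zero], mul_comm] at this
    exact mul_left_cancel₀ (ho i) this.symm
  ext i j
  rcases eq_or_ne i j with rfl | hij
  · rw [Matrix.smul_apply, Matrix.one_apply_eq, smul_eq_mul, mul_one, hdiag]
  · rw [Matrix.smul_apply, Matrix.one_apply_ne hij, smul_zero, hoff i j hij]

variable {K : Type w} [Field K] {V : Type v} [AddCommGroup V] [Module K V] {d : ℕ}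
  {ρ : Representation K B3 V} {b : Module.Basis (Fin d) K V} {lam : Fin d → K} {o : Fin d}

namespace IsGenericBraidRep

theorem qFamily_ne_zero (h : IsGenericBraidRep ρ b lam o) (i : Fin d) :
    qFamily ρ b lam o i ≠ 0 := by
  intro h0
  have := h.compress_ne_zero i
  rw [h.compress_one, h0, zero_smul] at this
  exact this rfl

theorem twistMatrix_apply_ne_zero (h : IsGenericBraidRep ρ b lam o) (i : Fin d) :
    twistMatrix ρ b o i ≠ 0 :=
  left_ne_zero_of_mul (right_ne_zero_of_mul (h.qFamily_ne_zero i))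

theorem twistMatrix_inv_apply_ne_zero (h : IsGenericBraidRep ρ b lam o) (i : Fin d) :
    (twistMatrix ρ b)⁻¹ i o ≠ 0 :=
  right_ne_zero_of_mul (right_ne_zero_of_mul (h.qFamily_ne_zero i))

theorem exists_isGenericBraidMatrix (h : IsGenericBraidRep ρ b lam o) :
    ∃ z, IsGenericBraidMatrix (twistMatrix ρ b) lam z o := by
  have hsq := eq_smul_one_of_commute h.injective h.twistMatrix_sq_commute
    (Commute.pow_self (twistMatrix ρ b) 2) h.twistMatrix_apply_ne_zero
  set z := (twistMatrix ρ b ^ 2) o o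
  have hinv : twistMatrix ρ b = z • (twistMatrix ρ b)⁻¹ := by
    have hunit : IsUnit (twistMatrix ρ b).det := isUnit_det_twistMatrix
    calc twistMatrix ρ b = twistMatrix ρ b ^ 2 * (twistMatrix ρ b)⁻¹ := by
          rw [pow_two, mul_assoc, Matrix.mul_nonsing_inv _ hunit, mul_one]
      _ = z • (twistMatrix ρ b)⁻¹ := by rw [hsq, smul_mul_assoc, one_mul]
  have hz : z ≠ 0 := fun h0 => h.twistMatrix_apply_ne_zero o (by
    rw [hinv, h0, zero_smul, Matrix.zero_apply])
  refine ⟨z, ⟨h.ne_zero, h.injective, hz, by rw [← pow_two, hsq], h.twistMatrix_rel⟩,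
    h.twistMatrix_apply_ne_zero, fun s => ?_⟩
  rw [hinv]
  exact mul_ne_zero hz (h.twistMatrix_inv_apply_ne_zero s)

theorem isIrreducible (h : IsGenericBraidRep ρ b lam o) : ρ.IsIrreducible := by
  obtain ⟨z, hT⟩ := h.exists_isGenericBraidMatrix
  have : Nontrivial (Subrepresentation ρ) := by
    refine ⟨⊥, ⊤, fun hbot => b.ne_zero o ?_⟩
    have hmem : b o ∈ (⊤ : Subrepresentation ρ).toSubmodule := Submodule.mem_top
    rw [← hbot] at hmem
    exact (Submodule.mem_bot K).1 hmem
  refine ⟨fun W => or_iff_not_imp_left.2 fun hW => ?_⟩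
  have hbasis {x : V} (hx : x ∈ W.toSubmodule) {i : Fin d} (hi : b.repr x i ≠ 0) :
      b i ∈ W.toSubmodule :=
    basis_mem_of_repr_ne_zero h.injective h.apply_basis
      (fun _ hy => W.apply_mem_toSubmodule (braidGen 0) hy) hx hi
  obtain ⟨x, hx, hx0⟩ : ∃ x ∈ W.toSubmodule, x ≠ 0 := by
    refine (Submodule.ne_bot_iff _).1 fun hbot => hW ?_
    exact Subrepresentation.toSubmodule_injective hbot
  obtain ⟨i, hi⟩ : ∃ i, b.repr x i ≠ 0 := by
    by_contra! hzero
    exact hx0 (b.repr.map_eq_zero_iff.1 (Finsupp.ext hzero))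
  have ho : b o ∈ W.toSubmodule := hbasis (W.apply_mem_toSubmodule halfTwist (hbasis hx hi)) (by
    rw [repr_halfTwist]
    exact hT.row_ne_zero i)
  refine Subrepresentation.toSubmodule_injective (eq_top_iff.2 ?_)
  change ⊤ ≤ W.toSubmodule
  rw [← b.span_eq, Submodule.span_le]
  rintro _ ⟨s, rfl⟩
  exact hbasis (W.apply_mem_toSubmodule halfTwist ho) (by
    rw [repr_halfTwist]
    exact hT.col_ne_zero s)

end IsGenericBraidRep

theorem isGamma_iff [NeZero d] {z : K} (hT : IsBraidMatrix (twistMatrix ρ b) lam z) (γ : K) :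
    IsGamma ρ lam γ ↔ γ ^ d = ∏ i, lam i ∧ z = (-1) ^ (d + 1) * γ ^ 6 := by
  have hsq : ρ (halfTwist ^ 2) = z • (1 : V →ₗ[K] V) := by
    apply (LinearMap.toMatrix b b).injective
    rw [map_smul, LinearMap.toMatrix_one, ← hT.sq, pow_two, map_mul, LinearMap.toMatrix_mul,
      twistMatrix]
  have : Nontrivial V := ⟨b 0, 0, b.ne_zero 0⟩
  refine and_congr_right fun _ => ?_
  change ρ (halfTwist ^ 2) = _ ↔ _
  rw [hsq]
  exact (smul_left_injective K (one_ne_zero (α := V →ₗ[K] V))).eq_iff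

theorem qFamily_eq_of_mul_eq {z : K} (hT : IsBraidMatrix (twistMatrix ρ b) lam z) {r s : Fin d}
    {q : K} (h : (polyP lam r).eval (lam r) * (polyP lam s).eval (lam s) *
      (twistMatrix ρ b r s * twistMatrix ρ b s r) = q * z) : qFamily ρ b lam r s = q := by
  have hz := hT.scalar_ne_zero
  have hinv : (twistMatrix ρ b)⁻¹ = z⁻¹ • twistMatrix ρ b := Matrix.inv_eq_right_inv (by
    rw [mul_smul_comm, hT.sq, smul_smul, inv_mul_cancel₀ hz, one_smul])
  rw [qFamily, hinv, Matrix.smul_apply, smul_eq_mul]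
  field_simp
  linear_combination h

theorem IsGenericBraidRep.isQFamily [IsAlgClosed K] (h : IsGenericBraidRep ρ b lam o) :
    IsQFamily ρ lam (qFamily ρ b lam) := by
  obtain ⟨z, hT⟩ := h.exists_isGenericBraidMatrix
  have : NeZero d := ⟨fun hd => (hd ▸ o).elim0⟩
  have hgamma := isGamma_iff hT.toIsBraidMatrix
  refine ⟨fun r s q => ?_, ?_, ?_, ?_, ?_⟩
  · rw [h.compress_zero]
    exact (smul_left_injective K (aeval_polyP_ne_zero h.injective h.apply_basis r)).eq_iff.trans
      eq_comm
  all_goals rintro rfl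
  · exact fun r s hrs => qFamily_eq_of_mul_eq hT.toIsBraidMatrix (hT.apply_mul_apply_two hrs)
  · exact fun r s k hl => qFamily_eq_of_mul_eq hT.toIsBraidMatrix (hT.apply_mul_apply_three hl)
  · simp only [hgamma]
    refine ⟨?_, fun γ hγ r s k l hl => qFamily_eq_of_mul_eq hT.toIsBraidMatrix
      (hT.apply_mul_apply_four hγ.1 (by rw [hγ.2]; ring) hl)⟩
    obtain ⟨γ, hγ, hz⟩ := hT.exists_gamma_four
    exact ⟨γ, hγ, by rw [hz]; ring⟩
  · simp only [hgamma]
    refine ⟨?_, fun γ hγ r s k l m hl => qFamily_eq_of_mul_eq hT.toIsBraidMatrix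
      (hT.apply_mul_apply_five hγ.1 (by rw [hγ.2]; ring) hl)⟩
    obtain ⟨γ, hγ, hz, -⟩ := hT.exists_gamma_moments_five
    exact ⟨γ, hγ, by rw [hz]; ring⟩

end GenericBraidRep

section Semisimple

variable {K : Type w} [Field K] {C : Type u} [Category.{v} C] [Preadditive C] [Linear K C]

theorem ScalarEnd.exists_smul {X : C} (h : ScalarEnd K X) (f : X ⟶ X) : ∃ a : K, f = a • 𝟙 X := by
  obtain ⟨a, ha⟩ := h.2 f
  exact ⟨a, ha.symm⟩

theorem ScalarEnd.id_ne_zero {X : C} (h : ScalarEnd K X) : 𝟙 X ≠ 0 := fun h0 =>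
  one_ne_zero (α := K) (h.1 (by simp [h0]))

theorem ScalarEnd.eq_of_smul_eq {X : C} (h : ScalarEnd K X) {a a' : K} (ha : a • 𝟙 X = a' • 𝟙 X) :
    a = a' :=
  h.1 ha

theorem ScalarEnd.of_iso {X Y : C} (e : X ≅ Y) (hY : ScalarEnd K Y) : ScalarEnd K X := by
  refine ⟨fun a a' haa' => hY.1 ?_, fun f => ?_⟩
  · simpa using congrArg (fun f => e.inv ≫ f ≫ e.hom) haa'
  · obtain ⟨a, ha⟩ := hY.2 (e.inv ≫ f ≫ e.hom)
    exact ⟨a, by simpa using congrArg (fun f => e.hom ≫ f ≫ e.inv) ha⟩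

variable [MonoidalCategory C]

section

variable [SemisimpleCategory K C]

theorem isIso_of_ne_zero {X Y : C} (hX : ScalarEnd K X) (hY : ScalarEnd K Y) {f : X ⟶ Y}
    (hf : f ≠ 0) : IsIso f := by
  obtain ⟨e⟩ : Nonempty (X ≅ Y) := by
    by_contra h
    exact hf (SemisimpleCategory.hom_eq_zero hX hY (not_nonempty_iff.1 h) f)
  obtain ⟨a, ha⟩ := hX.exists_smul (f ≫ e.inv)
  obtain rfl : f = a • e.hom := by
    rw [← Category.comp_id f, ← e.inv_hom_id, ← Category.assoc, ha, Linear.smul_comp,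
      Category.id_comp]
  have ha0 : a ≠ 0 := fun h0 => hf (by rw [h0, zero_smul])
  refine ⟨a⁻¹ • e.inv, ?_, ?_⟩
  · rw [Linear.smul_comp, Linear.comp_smul, smul_smul, mul_inv_cancel₀ ha0, one_smul, e.hom_inv_id]
  · rw [Linear.smul_comp, Linear.comp_smul, smul_smul, inv_mul_cancel₀ ha0, one_smul, e.inv_hom_id]

theorem mono_of_ne_zero {S X : C} (hS : ScalarEnd K S) {g : S ⟶ X} (hg : g ≠ 0) : Mono g := by
  apply Preadditive.mono_of_cancel_zero
  intro W h hh
  obtain ⟨n, T, f', g', hT, hsum⟩ := SemisimpleCategory.domination (K := K) W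
  rw [← Category.id_comp h, ← hsum, Preadditive.sum_comp]
  refine Finset.sum_eq_zero fun l _ => ?_
  have hzero : g' l ≫ h = 0 := by
    by_contra hne
    have := isIso_of_ne_zero (hT l) hS hne
    apply hg
    rw [← cancel_epi (g' l ≫ h), Category.assoc, hh, Limits.comp_zero, Limits.comp_zero]
  rw [Category.assoc, hzero, Limits.comp_zero]

variable (K) in
theorem scalarEnd_of_simple (X : C) [Simple X] : ScalarEnd K X := by
  obtain ⟨n, S, f, g, hS, hsum⟩ := SemisimpleCategory.domination (K := K) X
  obtain ⟨k, hk⟩ : ∃ k, g k ≠ 0 := by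
    by_contra! h
    exact id_nonzero X (by
      rw [← hsum, Finset.sum_eq_zero fun k _ => by rw [h k, Limits.comp_zero]])
  have := mono_of_ne_zero (hS k) hk
  have := isIso_of_mono_of_nonzero hk
  exact (hS k).of_iso (asIso (g k)).symm

end

section Duals

variable [MonoidalPreadditive C] [MonoidalLinear K C]

variable (K) in
/-- `tensorLeftHomEquiv` as a linear equivalence. -/
def tensorLeftLinearEquiv (X Y Y' Z : C) [ExactPairing Y Y'] :
    (Y' ⊗ X ⟶ Z) ≃ₗ[K] (X ⟶ Y ⊗ Z) where
  __ := tensorLeftHomEquiv X Y Y' Z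
  map_add' f g := by simp [tensorLeftHomEquiv]
  map_smul' a f := by simp [tensorLeftHomEquiv]

variable (K) in
/-- `tensorRightHomEquiv` as a linear equivalence. -/
def tensorRightLinearEquiv (X Y Y' Z : C) [ExactPairing Y Y'] :
    (X ⊗ Y ⟶ Z) ≃ₗ[K] (X ⟶ Z ⊗ Y') where
  __ := tensorRightHomEquiv X Y Y' Z
  map_add' f g := by simp [tensorRightHomEquiv]
  map_smul' a f := by simp [tensorRightHomEquiv]

theorem tensorRightLinearEquiv_apply {X Y Y' Z : C} [ExactPairing Y Y'] (f : X ⊗ Y ⟶ Z) :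
    tensorRightLinearEquiv K X Y Y' Z f =
      (ρ_ _).inv ≫ X ◁ η_ Y Y' ≫ (α_ _ _ _).inv ≫ f ▷ Y' :=
  rfl

variable (K) in
theorem tensorLeftLinearEquiv_rightUnitor (Y Y' : C) [ExactPairing Y Y'] :
    tensorLeftLinearEquiv K (𝟙_ C) Y Y' Y' (ρ_ Y').hom = η_ Y Y' := by
  change (λ_ _).inv ≫ η_ _ _ ▷ _ ≫ (α_ _ _ _).hom ≫ _ ◁ (ρ_ Y').hom = _
  monoidal

variable (K) in
theorem tensorRightLinearEquiv_leftUnitor (Y Y' : C) [ExactPairing Y Y'] :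
    tensorRightLinearEquiv K (𝟙_ C) Y Y' Y (λ_ Y).hom = η_ Y Y' := by
  change (ρ_ _).inv ≫ _ ◁ η_ _ _ ≫ (α_ _ _ _).inv ≫ (λ_ Y).hom ▷ _ = _
  monoidal

variable (K) in
theorem tensorLeftLinearEquiv_evaluation (Y Y' : C) [ExactPairing Y Y'] :
    tensorLeftLinearEquiv K Y Y Y' (𝟙_ C) (ε_ Y Y') = (ρ_ Y).inv := by
  change (λ_ _).inv ≫ η_ _ _ ▷ _ ≫ (α_ _ _ _).hom ≫ _ ◁ ε_ _ _ = _
  rw [ExactPairing.evaluation_coevaluation, Iso.inv_hom_id_assoc]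

namespace ScalarEnd

variable {Y Y' : C} [ExactPairing Y Y']

theorem exists_coevaluation_smul (h : ScalarEnd K Y) (f : 𝟙_ C ⟶ Y ⊗ Y') :
    ∃ a : K, f = a • η_ Y Y' := by
  obtain ⟨a, ha⟩ := h.exists_smul
    ((λ_ Y).inv ≫ (tensorRightLinearEquiv K (𝟙_ C) Y Y' Y).symm f)
  refine ⟨a, ?_⟩
  rwa [Iso.inv_comp_eq, Linear.comp_smul, Category.comp_id, LinearEquiv.symm_apply_eq, map_smul,
    tensorRightLinearEquiv_leftUnitor] at ha

theorem exists_evaluation_smul (h : ScalarEnd K Y) (f : Y' ⊗ Y ⟶ 𝟙_ C) :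
    ∃ a : K, f = a • ε_ Y Y' := by
  obtain ⟨a, ha⟩ := h.exists_smul (tensorLeftLinearEquiv K Y Y Y' (𝟙_ C) f ≫ (ρ_ Y).hom)
  refine ⟨a, (tensorLeftLinearEquiv K Y Y Y' (𝟙_ C)).injective ?_⟩
  rwa [map_smul, tensorLeftLinearEquiv_evaluation, ← Category.id_comp (ρ_ Y).inv,
    ← Linear.smul_comp, Iso.eq_comp_inv]

theorem evaluation_ne_zero (h : ScalarEnd K Y) : ε_ Y Y' ≠ 0 := by
  intro h0
  have hinv := tensorLeftLinearEquiv_evaluation K Y Y'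
  rw [h0, map_zero] at hinv
  exact (h.of_iso (ρ_ Y)).id_ne_zero (by rw [← (ρ_ Y).hom_inv_id, ← hinv, Limits.comp_zero])

theorem coevaluation_smul_injective (h : ScalarEnd K Y) :
    Function.Injective fun a : K => a • η_ Y Y' := by
  intro a a' haa'
  apply h.1
  simp only [← tensorRightLinearEquiv_leftUnitor K, ← map_smul] at haa'
  simpa using congrArg (fun f => (λ_ Y).inv ≫ f)
    ((tensorRightLinearEquiv K _ _ _ _).injective haa')

theorem of_exactPairing (h : ScalarEnd K Y) : ScalarEnd K Y' := by
  refine ⟨fun a a' haa' => h.coevaluation_smul_injective (Y' := Y') ?_, fun f => ?_⟩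
  · simpa [tensorLeftLinearEquiv_rightUnitor] using
      congrArg (fun f => tensorLeftLinearEquiv K (𝟙_ C) Y Y' Y' ((ρ_ Y').hom ≫ f)) haa'
  · obtain ⟨a, ha⟩ := h.exists_coevaluation_smul
      (tensorLeftLinearEquiv K (𝟙_ C) Y Y' Y' ((ρ_ Y').hom ≫ f))
    refine ⟨a, ?_⟩
    rw [← tensorLeftLinearEquiv_rightUnitor K, ← map_smul] at ha
    rw [← cancel_epi (ρ_ Y').hom, (tensorLeftLinearEquiv K _ _ _ _).injective ha,
      Linear.comp_smul, Category.comp_id]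

end ScalarEnd

theorem exists_exactPairing_self [SemisimpleCategory K C] {Z : C} [HasRightDual Z]
    (hZ : ScalarEnd K Z) (h : IsSelfDual K Z) : Nonempty (ExactPairing Z Z) := by
  obtain ⟨i, p, hip, -⟩ := h
  have hi : i ≠ 0 := by
    rintro rfl
    rw [Limits.zero_comp] at hip
    exact (SemisimpleCategory.scalarEnd_unit (K := K) (C := C)).id_ne_zero hip.symm
  let f : Zᘁ ⟶ Z := (ρ_ Zᘁ).inv ≫ (tensorLeftLinearEquiv K (𝟙_ C) Z Zᘁ Z).symm i
  have hf : f ≠ 0 := by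
    intro h0
    rw [Iso.inv_comp_eq, Limits.comp_zero, LinearEquiv.symm_apply_eq, map_zero] at h0
    exact hi h0
  have := isIso_of_ne_zero (hZ.of_exactPairing (Y' := Zᘁ)) hZ hf
  exact ⟨exactPairingCongrRight (asIso f).symm⟩

end Duals

end Semisimple

section Traces

variable {C : Type u} [Category.{v} C] [MonoidalCategory C]

theorem exists_mate {Y Y' W W' : C} [ExactPairing Y Y'] [ExactPairing W W'] (ι : Y ⟶ W) :
    ∃ j : W' ⟶ Y', η_ W W' ≫ W ◁ j = η_ Y Y' ≫ ι ▷ Y' ∧ j ▷ Y ≫ ε_ Y Y' = W' ◁ ι ≫ ε_ W W' := by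
  let hY : HasRightDual Y := ⟨Y'⟩
  let hW : HasRightDual W := ⟨W'⟩
  exact ⟨ιᘁ, coevaluation_comp_rightAdjointMate ι, rightAdjointMate_comp_evaluation ι⟩

variable [BraidedCategory C]

theorem braiding_slide {A B D : C} (e : B ⊗ D ⟶ 𝟙_ C) :
    (β_ A B).hom ▷ D ⊗≫ B ◁ (β_ A D).hom ⊗≫ e ▷ A = 𝟙 _ ⊗≫ A ◁ e ⊗≫ 𝟙 _ := by
  have hnat := BraidedCategory.braiding_naturality_right A e
  rw [braiding_tensorUnit_right, BraidedCategory.braiding_tensor_right_hom] at hnat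
  calc _ = 𝟙 _ ⊗≫ (((α_ A B D).inv ≫ (β_ A B).hom ▷ D ≫ (α_ B A D).hom ≫
        B ◁ (β_ A D).hom ≫ (α_ B D A).inv) ≫ e ▷ A) := by monoidal
    _ = _ := by
      rw [← hnat]
      monoidal

theorem braiding_evaluation_tensor {A B A' B' : C} (a : A' ⊗ A ⟶ 𝟙_ C) (b : B' ⊗ B ⟶ 𝟙_ C) :
    ((β_ A B).hom ≫ (β_ B A).hom) ▷ (B' ⊗ A') ≫ (β_ (A ⊗ B) (B' ⊗ A')).hom ≫
        (𝟙 _ ⊗≫ B' ◁ (a ▷ B) ⊗≫ b) =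
      𝟙 _ ⊗≫ A ◁ ((β_ B B').hom ≫ b) ▷ A' ⊗≫ (β_ A A').hom ≫ a := by
  have hnat := BraidedCategory.braiding_naturality_left (β_ B A).hom B'
  have hslideA := braiding_slide (A := B) ((β_ A A').hom ≫ a)
  have hslideB := braiding_slide (A := A) ((β_ B B').hom ≫ b)
  calc _ = 𝟙 _ ⊗≫ (β_ A B).hom ▷ (B' ⊗ A') ⊗≫
        ((β_ B A).hom ▷ B' ≫ (β_ (A ⊗ B) B').hom) ▷ A' ⊗≫
          B' ◁ (β_ (A ⊗ B) A').hom ⊗≫ B' ◁ (a ▷ B) ⊗≫ b := by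
        rw [BraidedCategory.braiding_tensor_right_hom (A ⊗ B) B' A']
        monoidal
    _ = 𝟙 _ ⊗≫ (β_ A B).hom ▷ (B' ⊗ A') ⊗≫ (β_ (B ⊗ A) B').hom ▷ A' ⊗≫
          B' ◁ ((β_ B A).hom ▷ A' ⊗≫ A ◁ (β_ B A').hom ⊗≫ ((β_ A A').hom ≫ a) ▷ B) ⊗≫ b := by
        rw [hnat, BraidedCategory.braiding_tensor_left_hom A B A']
        monoidal
    _ = 𝟙 _ ⊗≫ (β_ A B).hom ▷ (B' ⊗ A') ⊗≫ B ◁ (β_ A B').hom ▷ A' ⊗≫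
          (β_ B B').hom ▷ (A ⊗ A') ⊗≫ ((B' ⊗ B) ◁ ((β_ A A').hom ≫ a) ≫ b ▷ 𝟙_ C) ⊗≫ 𝟙 _ := by
        rw [hslideA, BraidedCategory.braiding_tensor_left_hom B A B']
        monoidal
    _ = 𝟙 _ ⊗≫ ((β_ A B).hom ▷ B' ⊗≫ B ◁ (β_ A B').hom ⊗≫
          ((β_ B B').hom ≫ b) ▷ A) ▷ A' ⊗≫ (β_ A A').hom ≫ a := by
        rw [whisker_exchange]
        monoidal
    _ = _ := by
        rw [hslideB]
        monoidal

variable [RightRigidCategory C] [RibbonCategory C]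

theorem ribbonTrace_of_retract {Y W W' : C} [ExactPairing W W'] {ι : Y ⟶ W} {π : W ⟶ Y}
    (h : ι ≫ π = 𝟙 Y) :
    ribbonTrace (𝟙 Y) = η_ W W' ≫ (π ≫ ι) ▷ W' ≫ (RibbonCategory.twist W).hom ▷ W' ≫
      (β_ W W').hom ≫ ε_ W W' := by
  obtain ⟨j, hcoev, hev⟩ := exists_mate (Y' := Yᘁ) (W' := W') ι
  have hθ : (RibbonCategory.twist Y).hom = ι ≫ (RibbonCategory.twist W).hom ≫ π := by
    rw [← Category.assoc, RibbonCategory.twist_naturality, Category.assoc, h, Category.comp_id]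
  have hnat : (π ≫ ι) ≫ (RibbonCategory.twist W).hom =
      (RibbonCategory.twist W).hom ≫ π ≫ ι := RibbonCategory.twist_naturality _
  rw [ribbonTrace, Category.id_comp, hθ, comp_whiskerRight, Category.assoc,
    ← Category.assoc (η_ Y Yᘁ), ← hcoev, Category.assoc, whisker_exchange_assoc,
    BraidedCategory.braiding_naturality_right_assoc, hev,
    ← BraidedCategory.braiding_naturality_left_assoc, ← comp_whiskerRight_assoc,
    ← comp_whiskerRight_assoc, hnat, Category.assoc]

end Traces

section PartialTrace

variable {C : Type u} [Category.{v} C] [MonoidalCategory C] {Z : C} [ExactPairing Z Z]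

/-- The partial trace of an endomorphism of `Z ⊗ Z` over the second tensor factor, formed with a
duality of `Z` with itself instead of the ribbon structure. -/
def partialTrace (q : Z ⊗ Z ⟶ Z ⊗ Z) : Z ⟶ Z :=
  (ρ_ Z).inv ≫ (Z ◁ η_ Z Z ≫ (α_ Z Z Z).inv) ≫ actLeft q ≫
    ((α_ Z Z Z).hom ≫ Z ◁ ε_ Z Z) ≫ (ρ_ Z).hom

theorem coevaluation_comp_partialTrace_comp_evaluation (q : Z ⊗ Z ⟶ Z ⊗ Z) :
    η_ (Z ⊗ Z) (Z ⊗ Z) ≫ q ▷ (Z ⊗ Z) ≫ (𝟙 _ ⊗≫ Z ◁ ε_ Z Z ▷ Z ⊗≫ ε_ Z Z) =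
      η_ Z Z ≫ partialTrace q ▷ Z ≫ ε_ Z Z := by
  rw [ExactPairing.tensor_coevaluation, partialTrace, actLeft]
  monoidal

theorem actRight_comp_actLeft_comp_actRight (q : Z ⊗ Z ⟶ Z ⊗ Z) :
    actRight (ε_ Z Z ≫ η_ Z Z) ≫ actLeft q ≫ actRight (ε_ Z Z ≫ η_ Z Z) =
      ((α_ Z Z Z).hom ≫ Z ◁ ε_ Z Z ≫ (ρ_ Z).hom) ≫ partialTrace q ≫
        (ρ_ Z).inv ≫ Z ◁ η_ Z Z ≫ (α_ Z Z Z).inv := by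
  simp [actRight, partialTrace]

variable {K : Type w} [Field K] [Preadditive C] [Linear K C]

theorem actRight_comp_actLeft_comp_actRight_eq_smul [MonoidalPreadditive C] [MonoidalLinear K C]
    {p q : Z ⊗ Z ⟶ Z ⊗ Z} {c x : K} (hp : p = c • (ε_ Z Z ≫ η_ Z Z))
    (hx : partialTrace q = x • 𝟙 Z) :
    actRight p ≫ actLeft q ≫ actRight p = (c * x) • actRight p := by
  have hright : actRight p = c • actRight (ε_ Z Z ≫ η_ Z Z) := by
    simp [hp, actRight]
  rw [hright, Linear.smul_comp, Linear.comp_smul, Linear.comp_smul,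
    actRight_comp_actLeft_comp_actRight, hx]
  simp [actRight, smul_smul, mul_comm]

theorem exists_comp_eq_smul_evaluation_comp_coevaluation [MonoidalPreadditive C]
    [MonoidalLinear K C] [SemisimpleCategory K C] (hZ : ScalarEnd K Z) {δ : K}
    (hδ : η_ Z Z ≫ ε_ Z Z = δ • 𝟙 (𝟙_ C)) {i : 𝟙_ C ⟶ Z ⊗ Z} {p : Z ⊗ Z ⟶ 𝟙_ C}
    (hip : i ≫ p = 𝟙 _) : ∃ c : K, p ≫ i = c • (ε_ Z Z ≫ η_ Z Z) ∧ c * δ = 1 := by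
  obtain ⟨a, rfl⟩ := hZ.exists_evaluation_smul p
  obtain ⟨a', rfl⟩ := hZ.exists_coevaluation_smul i
  refine ⟨a * a', by rw [Linear.smul_comp, Linear.comp_smul, smul_smul], ?_⟩
  apply (SemisimpleCategory.scalarEnd_unit (K := K) (C := C)).eq_of_smul_eq
  rw [Linear.smul_comp, Linear.comp_smul, hδ, smul_smul, smul_smul] at hip
  rw [one_smul, mul_comm a, hip]

end PartialTrace

section Dimensions

variable {C : Type u} [Category.{v} C] [Preadditive C] [MonoidalCategory C]
  [BraidedCategory C] [RightRigidCategory C] [RibbonCategory C]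
  {K : Type w} [Field K] [Linear K C]

theorem catDim_eq_of_ribbonTrace [SemisimpleCategory K C] {X : C} {a : K}
    (h : ribbonTrace (𝟙 X) = a • 𝟙 (𝟙_ C)) : catDim K X = a :=
  (SemisimpleCategory.scalarEnd_unit (K := K) (C := C)).eq_of_smul_eq
    ((catDim_smul_id K X).trans h)

variable [MonoidalPreadditive C] [MonoidalLinear K C]

theorem twist_tensor_self_of_eq_smul {Z : C} {t : K}
    (ht : (RibbonCategory.twist Z).hom = t • 𝟙 Z) :
    (RibbonCategory.twist (Z ⊗ Z)).hom = t ^ 2 • ((β_ Z Z).hom ≫ (β_ Z Z).hom) := by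
  rw [RibbonCategory.twist_tensor, ht]
  simp [MonoidalCategory.tensorHom_def, smul_smul, pow_two]

theorem twist_unit (K : Type w) [Field K] [Linear K C] [MonoidalLinear K C]
    [SemisimpleCategory K C] : (RibbonCategory.twist (𝟙_ C)).hom = 𝟙 (𝟙_ C) := by
  have hunit : ScalarEnd K (𝟙_ C) := SemisimpleCategory.scalarEnd_unit
  obtain ⟨s, hs⟩ := hunit.exists_smul (RibbonCategory.twist (𝟙_ C)).hom
  have hnat := RibbonCategory.twist_naturality (λ_ (𝟙_ C)).hom
  rw [twist_tensor_self_of_eq_smul hs, hs] at hnat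
  have hsq : s = s ^ 2 := (hunit.of_iso (λ_ (𝟙_ C))).eq_of_smul_eq (by
    simpa [braiding_tensorUnit_left, unitors_equal, unitors_inv_equal] using
      congrArg (fun f => f ≫ (λ_ (𝟙_ C)).inv) hnat)
  have hs0 : s ≠ 0 := by
    rintro rfl
    apply hunit.id_ne_zero
    rw [← (RibbonCategory.twist (𝟙_ C)).hom_inv_id, hs, zero_smul, Limits.zero_comp]
  rw [hs, mul_left_cancel₀ hs0 (by rw [← pow_two, ← hsq, mul_one] : s * s = s * 1), one_smul]

variable [SemisimpleCategory K C] {Z : C} [ExactPairing Z Z]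

theorem twist_mul_braiding_sq_eq_one (hZ : ScalarEnd K Z) {t μ : K}
    (ht : (RibbonCategory.twist Z).hom = t • 𝟙 Z) (hμ : (β_ Z Z).hom ≫ ε_ Z Z = μ • ε_ Z Z) :
    (t * μ) ^ 2 = 1 := by
  have hnat := RibbonCategory.twist_naturality (ε_ Z Z)
  rw [twist_unit K, Category.comp_id, twist_tensor_self_of_eq_smul ht, Linear.smul_comp,
    Category.assoc, hμ, Linear.comp_smul, hμ, smul_smul, smul_smul] at hnat
  apply smul_left_injective K (hZ.evaluation_ne_zero (Y' := Z))
  change (t * μ) ^ 2 • ε_ Z Z = (1 : K) • ε_ Z Z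
  rw [one_smul, mul_pow, pow_two μ, ← mul_assoc, ← hnat]

theorem catDim_sq_eq (hZ : ScalarEnd K Z) {δ : K} (hδ : η_ Z Z ≫ ε_ Z Z = δ • 𝟙 (𝟙_ C)) :
    catDim K Z ^ 2 = δ ^ 2 := by
  obtain ⟨t, ht⟩ := hZ.exists_smul (RibbonCategory.twist Z).hom
  obtain ⟨μ, hμ⟩ := hZ.exists_evaluation_smul ((β_ Z Z).hom ≫ ε_ Z Z)
  have hdim : catDim K Z = t * μ * δ := by
    apply catDim_eq_of_ribbonTrace
    rw [ribbonTrace_of_retract (W := Z) (W' := Z) (Category.id_comp (𝟙 Z)), Category.id_comp, ht,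
      hμ]
    simp only [MonoidalLinear.smul_whiskerRight, id_whiskerRight, Linear.smul_comp,
      Linear.comp_smul, Category.id_comp, hδ, smul_smul]
    congr 1
    ring
  rw [hdim, mul_pow, twist_mul_braiding_sq_eq_one hZ ht hμ, one_mul]

theorem catDim_eq_of_partialTrace (hZ : ScalarEnd K Z) {δ : K}
    (hδ : η_ Z Z ≫ ε_ Z Z = δ • 𝟙 (𝟙_ C)) {Y : C} {ι : Y ⟶ Z ⊗ Z} {π : Z ⊗ Z ⟶ Y}
    (hιπ : ι ≫ π = 𝟙 Y) {x : K} (hx : partialTrace (π ≫ ι) = x • 𝟙 Z) :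
    catDim K Y = x * δ := by
  obtain ⟨t, ht⟩ := hZ.exists_smul (RibbonCategory.twist Z).hom
  obtain ⟨μ, hμ⟩ := hZ.exists_evaluation_smul ((β_ Z Z).hom ≫ ε_ Z Z)
  have hev := braiding_evaluation_tensor (ε_ Z Z) (ε_ Z Z)
  have htrace := coevaluation_comp_partialTrace_comp_evaluation (π ≫ ι)
  rw [hμ] at hev
  rw [hx] at htrace
  apply catDim_eq_of_ribbonTrace
  rw [ribbonTrace_of_retract (W := Z ⊗ Z) (W' := Z ⊗ Z) hιπ, twist_tensor_self_of_eq_smul ht,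
    ExactPairing.tensor_evaluation, MonoidalLinear.smul_whiskerRight, Linear.smul_comp, hev]
  simp only [monoidalComp, MonoidalLinear.smul_whiskerRight, MonoidalLinear.whiskerLeft_smul,
    Linear.smul_comp, Linear.comp_smul, smul_smul, id_whiskerRight, Category.id_comp, hδ]
    at htrace ⊢
  rw [htrace, smul_smul]
  congr 1
  linear_combination x * δ * twist_mul_braiding_sq_eq_one hZ ht hμ

variable {i : 𝟙_ C ⟶ Z ⊗ Z} {p : Z ⊗ Z ⟶ 𝟙_ C}

theorem catDim_ne_zero_of_retract (hZ : ScalarEnd K Z) (hip : i ≫ p = 𝟙 _) : catDim K Z ≠ 0 := by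
  intro h0
  obtain ⟨δ, hδ⟩ :=
    (SemisimpleCategory.scalarEnd_unit (K := K) (C := C)).exists_smul (η_ Z Z ≫ ε_ Z Z)
  obtain ⟨c, -, hc⟩ := exists_comp_eq_smul_evaluation_comp_coevaluation hZ hδ hip
  have hsq := catDim_sq_eq hZ hδ
  rw [h0, zero_pow two_ne_zero] at hsq
  exact pow_ne_zero 2 (right_ne_zero_of_mul_eq_one hc) hsq.symm

theorem actRight_comp_actLeft_comp_actRight_of_retract (hZ : ScalarEnd K Z) (hip : i ≫ p = 𝟙 _)
    {Y : C} {ι : Y ⟶ Z ⊗ Z} {π : Z ⊗ Z ⟶ Y} (hιπ : ι ≫ π = 𝟙 Y) :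
    actRight (p ≫ i) ≫ actLeft (π ≫ ι) ≫ actRight (p ≫ i) =
      (catDim K Y / catDim K Z ^ 2) • actRight (p ≫ i) := by
  obtain ⟨δ, hδ⟩ :=
    (SemisimpleCategory.scalarEnd_unit (K := K) (C := C)).exists_smul (η_ Z Z ≫ ε_ Z Z)
  obtain ⟨c, hp, hc⟩ := exists_comp_eq_smul_evaluation_comp_coevaluation hZ hδ hip
  obtain ⟨x, hx⟩ := hZ.exists_smul (partialTrace (π ≫ ι))
  have hδ0 : δ ≠ 0 := right_ne_zero_of_mul_eq_one hc
  rw [actRight_comp_actLeft_comp_actRight_eq_smul hp hx, catDim_eq_of_partialTrace hZ hδ hιπ hx,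
    catDim_sq_eq hZ hδ]
  congr 1
  field_simp
  linear_combination x * hc

end Dimensions

section Decomposition

variable {C : Type u} [Category.{v} C] [Preadditive C] {ι : Type} {X : C} {Y : ι → C}
  [HasBiproduct Y] (e : X ≅ ⨁ Y)

theorem sum_summandProj [Fintype ι] : ∑ i, summandProj e i = 𝟙 X := by
  have h (i : ι) : summandProj e i = e.hom ≫ (biproduct.π Y i ≫ biproduct.ι Y i) ≫ e.inv := by
    simp [summandProj]
  simp_rw [h, ← Preadditive.comp_sum, ← Preadditive.sum_comp, biproduct.total]
  simp

theorem ι_inv_comp_hom_π (i : ι) :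
    (biproduct.ι Y i ≫ e.inv) ≫ e.hom ≫ biproduct.π Y i = 𝟙 (Y i) := by
  simp

variable {K : Type w} [Field K] [Linear K C]

theorem linearIndependent_summandProj [Finite ι] (hY : ∀ i, ScalarEnd K (Y i)) :
    LinearIndependent K (summandProj e) := by
  cases nonempty_fintype ι
  rw [Fintype.linearIndependent_iff]
  intro g hg j
  apply (hY j).eq_of_smul_eq
  have hj := congrArg (fun f => (biproduct.ι Y j ≫ e.inv) ≫ f ≫ e.hom ≫ biproduct.π Y j) hg
  simp only [Preadditive.comp_sum, Preadditive.sum_comp] at hj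
  rw [Fintype.sum_eq_single j] at hj
  · simpa [summandProj] using hj
  · intro i hij
    simp [summandProj, biproduct.ι_π_ne_assoc Y hij.symm]

variable [MonoidalCategory C] [SemisimpleCategory K C]

theorem span_summandProj [Finite ι] (hY : ∀ i, ScalarEnd K (Y i))
    (hne : ∀ i j, i ≠ j → IsEmpty (Y i ≅ Y j)) :
    ⊤ ≤ Submodule.span K (Set.range (summandProj e)) := by
  cases nonempty_fintype ι
  rintro g -
  have hg : g = ∑ i, ∑ j, summandProj e i ≫ g ≫ summandProj e j := by
    simp_rw [← Preadditive.comp_sum, ← Preadditive.sum_comp, sum_summandProj,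
      Category.id_comp, Category.comp_id]
  rw [hg]
  refine Submodule.sum_mem _ fun i _ => Submodule.sum_mem _ fun j _ => ?_
  have hij : summandProj e i ≫ g ≫ summandProj e j = (e.hom ≫ biproduct.π Y i) ≫
      ((biproduct.ι Y i ≫ e.inv) ≫ g ≫ e.hom ≫ biproduct.π Y j) ≫ biproduct.ι Y j ≫ e.inv := by
    simp [summandProj]
  rw [hij]
  rcases eq_or_ne i j with rfl | h
  · obtain ⟨a, ha⟩ := (hY i).exists_smul ((biproduct.ι Y i ≫ e.inv) ≫ g ≫ e.hom ≫ biproduct.π Y i)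
    rw [ha, Linear.smul_comp, Linear.comp_smul, Category.id_comp]
    exact Submodule.smul_mem _ _ (Submodule.subset_span ⟨i, rfl⟩)
  · rw [SemisimpleCategory.hom_eq_zero (hY i) (hY j) (hne i j h)
      ((biproduct.ι Y i ≫ e.inv) ≫ g ≫ e.hom ≫ biproduct.π Y j), Limits.zero_comp, Limits.comp_zero]
    exact Submodule.zero_mem _

theorem exists_iso_unit [Finite ι] {Z : C} (e : Z ⊗ Z ≅ ⨁ Y) (hZ : IsSelfDual K Z)
    (hY : ∀ i, ScalarEnd K (Y i)) : ∃ i, Nonempty (Y i ≅ 𝟙_ C) := by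
  cases nonempty_fintype ι
  obtain ⟨j, p, hjp, -⟩ := hZ
  have hp : p ≠ 0 := by
    rintro rfl
    rw [Limits.comp_zero] at hjp
    exact (SemisimpleCategory.scalarEnd_unit (K := K) (C := C)).id_ne_zero hjp.symm
  obtain ⟨i, hi⟩ : ∃ i, (biproduct.ι Y i ≫ e.inv) ≫ p ≠ 0 := by
    by_contra! h
    apply hp
    rw [← Category.id_comp p, ← sum_summandProj e, Preadditive.sum_comp]
    refine Finset.sum_eq_zero fun i _ => ?_
    rw [summandProj, Category.assoc, h, Limits.comp_zero]
  have := isIso_of_ne_zero (hY i) SemisimpleCategory.scalarEnd_unit hi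
  exact ⟨i, ⟨asIso ((biproduct.ι Y i ≫ e.inv) ≫ p)⟩⟩

end Decomposition

section UnitSummand

variable {K : Type w} [Field K] {C : Type u} [Category.{v} C] [Preadditive C] [Linear K C]
  [MonoidalCategory C] [MonoidalPreadditive C] [MonoidalLinear K C] [BraidedCategory C]
  [RightRigidCategory C] [RibbonCategory C] [SemisimpleCategory K C] {ι : Type} {Y : ι → C}
  [HasBiproduct Y] {Z : C} [ExactPairing Z Z] (e : Z ⊗ Z ≅ ⨁ Y) (hZ : ScalarEnd K Z) {o : ι}

include e hZ

theorem catDim_ne_zero_of_unit_summand (ho : Nonempty (Y o ≅ 𝟙_ C)) : catDim K Z ≠ 0 := by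
  obtain ⟨φ⟩ := ho
  exact catDim_ne_zero_of_retract hZ (i := φ.inv ≫ biproduct.ι Y o ≫ e.inv)
    (p := (e.hom ≫ biproduct.π Y o) ≫ φ.hom) (by simp)

theorem actRight_summandProj_compress (ho : Nonempty (Y o ≅ 𝟙_ C)) (i : ι) :
    actRight (summandProj e o) ≫ actLeft (summandProj e i) ≫ actRight (summandProj e o) =
      (catDim K (Y i) / catDim K Z ^ 2) • actRight (summandProj e o) := by
  obtain ⟨φ⟩ := ho
  have hproj : summandProj e o =
      ((e.hom ≫ biproduct.π Y o) ≫ φ.hom) ≫ φ.inv ≫ biproduct.ι Y o ≫ e.inv := by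
    simp [summandProj]
  rw [hproj]
  exact actRight_comp_actLeft_comp_actRight_of_retract hZ (by simp) (ι_inv_comp_hom_π e i)

end UnitSummand

section BraidAction

variable {K : Type w} [Field K] {C : Type u} [Category.{v} C] [Preadditive C] [Linear K C] {d : ℕ}

theorem aeval_rightComp_polyP {W X : C} {T : X ⟶ X} {q : Fin d → (X ⟶ X)} {lam : Fin d → K}
    (hsum : ∑ i, q i = 𝟙 X) (hq : ∀ i, q i ≫ T = lam i • q i) (r : Fin d) :
    aeval (R := K) (A := Module.End K (W ⟶ X)) (Linear.rightComp K W T) (polyP lam r) =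
      (polyP lam r).eval (lam r) • Linear.rightComp K W (q r) := by
  ext f
  have hf : f = ∑ i, f ≫ q i := by rw [← Preadditive.comp_sum, hsum, Category.comp_id]
  have heig (i : Fin d) : Linear.rightComp K W T (f ≫ q i) = lam i • (f ≫ q i) := by
    rw [Linear.rightComp_apply, Category.assoc, hq, Linear.comp_smul]
  conv_lhs => rw [hf]
  rw [map_sum, Fintype.sum_eq_single r]
  · exact Module.End.aeval_apply_of_mem_apply_eq_smul (heig r)
  · intro i hir
    rw [Module.End.aeval_apply_of_mem_apply_eq_smul (heig i), eval_polyP_of_ne lam hir, zero_smul]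

variable [MonoidalCategory C] {Z : C} {Y : Fin d → C} [HasBiproduct Y] (e : Z ⊗ Z ≅ ⨁ Y)

section

variable [MonoidalPreadditive C]

theorem sum_actLeft_summandProj : ∑ i, actLeft (summandProj e i) = 𝟙 (cube Z) := by
  simp_rw [actLeft, ← sum_whiskerRight, sum_summandProj, id_whiskerRight]

theorem sum_actRight_summandProj : ∑ i, actRight (summandProj e i) = 𝟙 (cube Z) := by
  simp_rw [actRight, ← Preadditive.comp_sum, ← Preadditive.sum_comp, ← whiskerLeft_sum,
    sum_summandProj]
  simp

end

section

variable [BraidedCategory C]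

theorem braidRep_braidGen (j : Fin 2) :
    braidRep K Z (braidGen j) = Linear.rightComp K Z (braidAut Z j).hom := by
  ext f
  rw [braidRep_braidGen_apply, Linear.rightComp_apply]

variable {e} {lam : Fin d → K}
  (hlam : ∀ i, (biproduct.ι Y i ≫ e.inv) ≫ (β_ Z Z).hom = lam i • (biproduct.ι Y i ≫ e.inv))

include hlam

theorem summandProj_comp_braiding (i : Fin d) :
    summandProj e i ≫ (β_ Z Z).hom = lam i • summandProj e i := by
  rw [summandProj, Category.assoc, hlam, Linear.comp_smul]

variable [MonoidalPreadditive C] [MonoidalLinear K C]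

theorem actLeft_summandProj_comp_braidAut (i : Fin d) :
    actLeft (summandProj e i) ≫ (braidAut Z 0).hom = lam i • actLeft (summandProj e i) := by
  rw [braidAut_zero_hom, actLeft, actLeft, ← comp_whiskerRight, summandProj_comp_braiding hlam,
    MonoidalLinear.smul_whiskerRight]

theorem actRight_summandProj_comp_braidAut (i : Fin d) :
    actRight (summandProj e i) ≫ (braidAut Z 1).hom = lam i • actRight (summandProj e i) := by
  have hcomp : actRight (summandProj e i) ≫ actRight (β_ Z Z).hom =
      actRight (summandProj e i ≫ (β_ Z Z).hom) := by
    simp [actRight]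
  rw [braidAut_one_hom, hcomp, summandProj_comp_braiding hlam]
  simp [actRight]

theorem aeval_braidRep_zero_polyP (r : Fin d) :
    aeval (braidRep K Z (braidGen 0)) (polyP lam r) =
      (polyP lam r).eval (lam r) • Linear.rightComp K Z (actLeft (summandProj e r)) := by
  rw [braidRep_braidGen]
  exact aeval_rightComp_polyP (sum_actLeft_summandProj e) (actLeft_summandProj_comp_braidAut hlam) r

theorem aeval_braidRep_one_polyP (r : Fin d) :
    aeval (braidRep K Z (braidGen 1)) (polyP lam r) =
      (polyP lam r).eval (lam r) • Linear.rightComp K Z (actRight (summandProj e r)) := by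
  rw [braidRep_braidGen]
  exact aeval_rightComp_polyP (sum_actRight_summandProj e)
    (actRight_summandProj_comp_braidAut hlam) r

theorem aeval_braidRep_compress {o i : Fin d} {t : K}
    (ht : actRight (summandProj e o) ≫ actLeft (summandProj e i) ≫ actRight (summandProj e o) =
      t • actRight (summandProj e o)) :
    aeval (braidRep K Z (braidGen 1)) (polyP lam o) *
        aeval (braidRep K Z (braidGen 0)) (polyP lam i) *
          aeval (braidRep K Z (braidGen 1)) (polyP lam o) =
      ((polyP lam o).eval (lam o) * (polyP lam i).eval (lam i) * t) •
        aeval (braidRep K Z (braidGen 1)) (polyP lam o) := by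
  rw [aeval_braidRep_one_polyP hlam, aeval_braidRep_zero_polyP hlam]
  ext f
  simp only [Module.End.mul_apply, LinearMap.smul_apply, Linear.rightComp_apply, Linear.smul_comp,
    Category.assoc, ht, Linear.comp_smul, smul_smul]
  congr 1
  ring

end

end BraidAction

section BraidModule

variable {K : Type w} [Field K] {C : Type u} [Category.{v} C] [Preadditive C] [Linear K C]
  [MonoidalCategory C] [MonoidalPreadditive C] [MonoidalLinear K C] [BraidedCategory C]
  [SemisimpleCategory K C] {Z : C} {d : ℕ} {Y : Fin d → C} [HasBiproduct Y] [ExactPairing Z Z]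
  (e : Z ⊗ Z ≅ ⨁ Y) (hY : ∀ i, ScalarEnd K (Y i)) (hne : ∀ i j, i ≠ j → IsEmpty (Y i ≅ Y j))

/-- The basis of `Hom(Z, Z^{⊗ 3})` corresponding under duality to the basis of `End(Z ⊗ Z)` formed
by the projections onto the summands. -/
def summandBasis : Module.Basis (Fin d) K (Z ⟶ cube Z) :=
  (Module.Basis.mk (linearIndependent_summandProj e hY) (span_summandProj e hY hne)).map
    (tensorRightLinearEquiv K Z Z Z (Z ⊗ Z))

variable {e} {lam : Fin d → K}
  (hlam : ∀ i, (biproduct.ι Y i ≫ e.inv) ≫ (β_ Z Z).hom = lam i • (biproduct.ι Y i ≫ e.inv))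
  (hinj : Function.Injective lam)

include hlam hinj

theorem isDiagonalBraidRep_braidRep :
    IsDiagonalBraidRep (braidRep K Z) (summandBasis e hY hne) lam where
  injective := hinj
  apply_basis i := by
    rw [summandBasis, Module.Basis.map_apply, Module.Basis.mk_apply, braidRep_braidGen_apply,
      braidAut_zero_hom, ← map_smul, ← summandProj_comp_braiding hlam, tensorRightLinearEquiv_apply,
      tensorRightLinearEquiv_apply, actLeft]
    simp

variable [RightRigidCategory C] [RibbonCategory C] (hZ : ScalarEnd K Z) {o : Fin d}
  (ho : Nonempty (Y o ≅ 𝟙_ C))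

include hZ ho

theorem qFamily_braidRep (i : Fin d) :
    qFamily (braidRep K Z) (summandBasis e hY hne) lam o i =
      (polyP lam o).eval (lam o) * (polyP lam i).eval (lam i) *
        (catDim K (Y i) / catDim K Z ^ 2) :=
  (isDiagonalBraidRep_braidRep hY hne hlam hinj).qFamily_eq_of_compress_one
    (aeval_braidRep_compress hlam (actRight_summandProj_compress e hZ ho i))

theorem isGenericBraidRep_braidRep (hdim : ∀ i, catDim K (Y i) ≠ 0) :
    IsGenericBraidRep (braidRep K Z) (summandBasis e hY hne) lam o where
  toIsDiagonalBraidRep := isDiagonalBraidRep_braidRep hY hne hlam hinj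
  compress_ne_zero i := by
    have hdiag := isDiagonalBraidRep_braidRep hY hne hlam hinj
    rw [hdiag.compress_one, qFamily_braidRep hY hne hlam hinj hZ ho]
    have hZ0 := catDim_ne_zero_of_unit_summand e hZ ho
    exact smul_ne_zero (mul_ne_zero (mul_ne_zero (eval_polyP_self_ne_zero hinj o)
      (eval_polyP_self_ne_zero hinj i)) (div_ne_zero (hdim i) (pow_ne_zero 2 hZ0)))
      (hdiag.aeval_braidGen_one_ne_zero o)

end BraidModule

end BraidDim

end

theorem mainTheorem11 {K : Type w} [Field K] [IsAlgClosed K]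
    {C : Type u} [Category.{v} C] [Preadditive C] [Linear K C]
    [MonoidalCategory C] [MonoidalPreadditive C] [MonoidalLinear K C]
    [BraidedCategory C] [RightRigidCategory C] [RibbonCategory C] [SemisimpleCategory K C]
    (Z : C) [Simple Z] (hZ : IsSelfDual K Z)
    (d : ℕ) (Y : Fin d → C) [HasBiproduct Y] (e : Z ⊗ Z ≅ ⨁ Y)
    (hsimple : ∀ i, Simple (Y i))
    (hnoniso : ∀ i j, i ≠ j → IsEmpty (Y i ≅ Y j))
    (hdim : ∀ i, catDim K (Y i) ≠ 0)
    (lam : Fin d → K)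
    (hlam : ∀ i, (biproduct.ι Y i ≫ e.inv) ≫ (β_ Z Z).hom = lam i • (biproduct.ι Y i ≫ e.inv))
    (hinj : Function.Injective lam) :
    -- the lemma
    ((braidRep K Z).IsIrreducible ∧ Module.finrank K (Z ⟶ cube Z) = d ∧
      ∀ j : Fin 2,
        (∀ μ : K, Module.End.HasEigenvalue (braidRep K Z (braidGen j)) μ ↔ ∃ i, μ = lam i) ∧
        ∀ i, Module.finrank K (Module.End.maxGenEigenspace (braidRep K Z (braidGen j)) (lam i)) = 1) ∧
    -- the corollary
    (∃ i₁, Nonempty (Y i₁ ≅ 𝟙_ C)) ∧ ∀ i₁, Nonempty (Y i₁ ≅ 𝟙_ C) →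
      (∀ i, catDim K (Y i) • actRight (summandProj e i₁) =
        (catDim K Z) ^ 2 • (actRight (summandProj e i₁) ≫ actLeft (summandProj e i) ≫
          actRight (summandProj e i₁))) ∧
      ∃ Q : Fin d → Fin d → K, IsQFamily (braidRep K Z) lam Q ∧
        ∀ i, catDim K (Y i) = Q i₁ i * (catDim K Z) ^ 2 /
          ((polyP lam i₁).eval (lam i₁) * (polyP lam i).eval (lam i)) := by
  have hY i : ScalarEnd K (Y i) := have := hsimple i; scalarEnd_of_simple K (Y i)
  have hZs : ScalarEnd K Z := scalarEnd_of_simple K Z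
  obtain ⟨_⟩ := exists_exactPairing_self hZs hZ
  have hdiag := isDiagonalBraidRep_braidRep hY hnoniso hlam hinj
  have hgen {o} (ho : Nonempty (Y o ≅ 𝟙_ C)) :=
    isGenericBraidRep_braidRep hY hnoniso hlam hinj hZs ho hdim
  obtain ⟨o, ho⟩ := exists_iso_unit e hZ hY
  refine ⟨⟨(hgen ho).isIrreducible, ?_, fun j => ?_⟩, ⟨o, ho⟩, fun o ho =>
    ⟨fun i => ?_, qFamily _ (summandBasis e hY hnoniso) lam, (hgen ho).isQFamily, fun i => ?_⟩⟩
  · rw [Module.finrank_eq_card_basis (summandBasis e hY hnoniso), Fintype.card_fin]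
  · obtain ⟨b, hb⟩ := hdiag.exists_basis_braidGen j
    exact ⟨hasEigenvalue_iff_of_apply_eq_smul hb, finrank_maxGenEigenspace_eq_one hinj hb⟩
  · have hZ0 : catDim K Z ≠ 0 := catDim_ne_zero_of_unit_summand e hZs ho
    rw [actRight_summandProj_compress e hZs ho, smul_smul, mul_div_cancel₀ _ (pow_ne_zero 2 hZ0)]
  · have hZ0 : catDim K Z ≠ 0 := catDim_ne_zero_of_unit_summand e hZs ho
    have hPo := eval_polyP_self_ne_zero hinj o
    have hPi := eval_polyP_self_ne_zero hinj i
    rw [qFamily_braidRep hY hnoniso hlam hinj hZs ho]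
    field_simp
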